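/- **Setting.** Let $\mathcal X,\mathcal Y$ be the prompt and response spaces (measurable spaces, the $\sigma$-algebra of $\mathcal Y$ countably generated; e.g. any countable sets), $\rho$ a probability on $\mathcal X$, and $\pi_{\mathrm{ref}},\pi_{\mathrm{base}}$ Markov kernels from $\mathcal X$ to $\mathcal Y$. Write $\mathbb E_\pi[f]=\mathbb E_{x\sim\rho,\,y\sim\pi(\cdot\mid x)}[f(x,y)]$ and $\mathrm{KL}(\pi)=\mathbb E_{x\sim\rho}[\mathbb D_{\mathrm{KL}}(\pi(\cdot\mid x)\,\|\,\pi_{\mathrm{ref}}(\cdot\mid x))]$; a policy is a Markov kernel $\pi$ from $\mathcal X$ to $\mathcal Y$ with $\mathrm{KL}(\pi)<\infty$. There are $m\ge1$ objectives with measurable features $\phi_i:\mathcal X\times\mathcal Y\to\mathbb R^d$, $d\ge 1$, $\|\phi_i\|_2\le1$, and rewards $r_i^{\theta}=\langle\theta,\phi_i\rangle$. For $B\ge1$ and $C\in\mathbb R$ let $$\Theta_i=\{\theta\in\mathbb R^d:\ \|\theta\|_2\le B,\ 0\le r_i^\theta\le B \text{ everywhere},\ \mathbb E_{\pi_{\mathrm{base}}}[r_i^{\theta}]=C\}.$$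 Let $B'$ satisfy $\|\theta\|_2\le B'$ for all $i$ and $\theta\in\Theta_i$. The true rewards are $r_i^*=r_i^{\theta_i^*}$ with $\theta_i^*\in\Theta_i$. Let $\beta>0$. **Target.** Group $n\in\{1,\dots,N\}$ has weights $\alpha^{(n)}$ in the simplex, an exponent $p^{(n)}\in[-\infty,1]$ and a threshold $c^{(n)}\in\mathbb R$, and the target set $W^{(n)}=\{z\in\mathbb R^m_{\ge0}: (\sum_i\alpha_i^{(n)}z_i^{p^{(n)}})^{1/p^{(n)}}\ge c^{(n)}\}$ (the aggregate is the geometric mean $\prod_i z_i^{\alpha_i^{(n)}}$ if $p^{(n)}=0$, the minimum $\min_i z_i$ if $p^{(n)}=-\infty$, and $0$ if $p^{(n)}\in(-\infty,0)$ and some $z_i=0$ with $\alpha^{(n)}_i>0$). Put $W=\bigcap_{n}W^{(n)}$, $S(\pi)_i=\mathbb E_\pi[r_i^*]-\beta\,\mathrm{KL}(\pi)$, and $D(\pi)=d(S(\pi),W)$, the Euclidean distance. Let $\pi^*$ minimize $D$ over all policies. **Data.** For each $i$ there are $M\ge1$ random triples $(x,y_1,y_2)$ with an arbitrary joint law; given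 these triples, the $M$ labels of objective $i$ are independent, and $y_1$ is labelled the winner $y_w$ (and $y_2$ the loser $y_l$) with probability $\sigma(r_i^*(x,y_1)-r_i^*(x,y_2))$, $\sigma(z)=1/(1+e^{-z})$; otherwise $y_2$ is the winner. The resulting $M$ triples $(x,y_w,y_l)$ form $\mathcal D_i$, and $L_i(\theta)=-\sum_{(x,y_w,y_l)\in\mathcal D_i}\log\sigma(r_i^\theta(x,y_w)-r_i^\theta(x,y_l))$. Let $\Sigma_{\mathcal D_i}=\frac1M\sum_{(x,y_w,y_l)\in\mathcal D_i}(\phi_i(x,y_w)-\phi_i(x,y_l))(\phi_i(x,y_w)-\phi_i(x,y_l))^\top$. **Algorithm (MOPO-Offline).** Let $\eta=1/\sqrt M$, $T\ge1$, and $J(r^\theta,e,\pi)=\sum_i e_i\big(\mathbb E_\pi[r_i^{\theta_i}]-\beta\,\mathrm{KL}(\pi)\big)$. Start from any $\bar d^1$ in the probability simplex. In rounds $t=1,\dots,T$, choose $\theta^t\in\arg\max_{\theta\in\prod_i\Theta_i}\big(-\max_\pi J(r^\theta,\bar d^t,\pi)-\eta\sum_iL_i(\theta_i)\big)$ and a policy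 $\pi^t\in\arg\max_\pi J(r^{\theta^t},\bar d^t,\pi)$, put $(V^t)_i=\mathbb E_{\pi^t}[r_i^{\theta^t_i}]-\beta\,\mathrm{KL}(\pi^t)$ and $\overline V^t=\frac1t\sum_{j\le t}V^j$, and let $\bar d^{t+1}=d^{t+1}/\|d^{t+1}\|_1$ with $d^{t+1}=(\Pi_W(\overline V^t)-\overline V^t)/\|\Pi_W(\overline V^t)-\overline V^t\|_2$, where $\Pi_W$ is the Euclidean projection (if $\overline V^t\in W$, then $\bar d^{t+1}$ is any vector of the simplex). The output is $\tilde\pi^T=\frac1T\sum_{t=1}^T\pi^t$. **Theorem.** There are a polynomial $P$ in two variables, a constant $c$ and an integer $k\ge 0$, all universal, such that in every such setting and for every $\delta\in(0,1)$, with probability at least $1-\delta$, for every run of the algorithm, $\tilde\pi^T$ is a policy and $$D(\tilde\pi^T)-D(\pi^*)\le\frac{m^{3/2}\sqrt d}{\sqrt M}\,P\!\left(e^{B'},\Big(\min_i\lambda_{\min}(\Sigma_{\mathcal D_i})+\tfrac1M\Big)^{-1}\right)\Big(1+\log\frac{mdM}{\delta}\Big)^{k}+c\,\frac{B\sqrt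 m}{\sqrt T}\,(1+\log T)^{k}.$$ -/

import Mathlib

open MeasureTheory ProbabilityTheory InformationTheory
open scoped ENNReal

universe u v w

noncomputable section

namespace MOPO

/-- `ℝⁿ` with its Euclidean norm. -/
abbrev Vec (n : ℕ) : Type := EuclideanSpace ℝ (Fin n)

/-! ### Target sets -/

/-- The weighted `p`-mean `(∑ i, α i * z i ^ p) ^ (1 / p)` of a nonnegative vector `z`, for
`p ∈ [-∞, ∞)`.  The formula is extended by its usual limits: the minimum for `p = -∞`, the
geometric mean for `p = 0`, and the value `0` if `p < 0` and a coordinate of positive weight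
vanishes. -/
def pMean {m : ℕ} (α : Fin m → ℝ) (p : WithBot ℝ) (z : Fin m → ℝ) : ℝ :=
  open scoped Classical in
  match p with
  | ⊥ => ⨅ i, z i
  | WithBot.some p =>
      if p = 0 then ∏ i, z i ^ α i
      else if p < 0 ∧ ∃ i, 0 < α i ∧ z i = 0 then 0
      else (∑ i, α i * z i ^ p) ^ (1 / p)

/-- The aggregation rule of a group: weights in the simplex, an exponent `p ≤ 1` (possibly `-∞`)
and a threshold. -/
structure Group (m : ℕ) where
  α : Fin m → ℝ
  p : WithBot ℝ
  c : ℝ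
  α_nonneg : ∀ i, 0 ≤ α i
  α_sum : ∑ i, α i = 1
  p_le_one : p ≤ ((1 : ℝ) : WithBot ℝ)

/-- The target set `{z ≥ 0 | (∑ i, α i * z i ^ p) ^ (1 / p) ≥ c}` of a group. -/
def Group.target {m : ℕ} (g : Group m) : Set (Vec m) :=
  {z | (∀ i, 0 ≤ z i) ∧ g.c ≤ pMean g.α g.p (fun i => z i)}

/-- The target set of the consensus problem. -/
def consensusTarget {m N : ℕ} (g : Fin N → Group m) : Set (Vec m) := ⋂ n, (g n).target

/-! ### The model -/

/-- The data of the multi-objective alignment problem: the prompt distribution `ρ`, the reference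
and base policies, the feature maps `φ i`, the true reward parameters, the bound `B` on rewards and
parameters, the regularization `β`, and the constant `C` that normalizes the rewards. -/
structure Model (X : Type u) (Y : Type v) [MeasurableSpace X] [MeasurableSpace Y] (m d : ℕ) where
  ρ : Measure X
  piRef : Kernel X Y
  piBase : Kernel X Y
  φ : Fin m → X → Y → Vec d
  θstar : Fin m → Vec d
  B : ℝ
  β : ℝ
  C : ℝ
  prob_ρ : IsProbabilityMeasure ρ
  markov_ref : IsMarkovKernel piRef
  markov_base : IsMarkovKernel piBase
  φ_measurable : ∀ i, Measurable (Function.uncurry (φ i))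
  φ_norm : ∀ i x y, ‖φ i x y‖ ≤ 1
  one_le_B : 1 ≤ B
  β_pos : 0 < β

namespace Model

variable {X : Type u} {Y : Type v} [MeasurableSpace X] [MeasurableSpace Y] {m d : ℕ}

/-- The linear reward `⟨θ, φ i x y⟩` for objective `i`. -/
def reward (Q : Model X Y m d) (i : Fin m) (θ : Vec d) (x : X) (y : Y) : ℝ :=
  inner ℝ θ (Q.φ i x y)

/-- `𝔼_π[f] = 𝔼_{x ∼ ρ, y ∼ π(·∣x)}[f x y]`. -/
def expect (Q : Model X Y m d) (π : Kernel X Y) (f : X → Y → ℝ) : ℝ :=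
  ∫ x, ∫ y, f x y ∂(π x) ∂Q.ρ

/-- `𝔼_{x ∼ ρ}[KL(π(·∣x) ‖ π_ref(·∣x))]`, possibly infinite. -/
def kl (Q : Model X Y m d) (π : Kernel X Y) : ℝ≥0∞ :=
  ∫⁻ x, klDiv (π x) (Q.piRef x) ∂Q.ρ

/-- The policies over which one optimizes: Markov kernels of finite divergence from `π_ref`.
(A policy of infinite divergence has objective value `-∞` in every maximization below, and is at
distance `+∞` from every target set.) -/
def IsPolicy (Q : Model X Y m d) (π : Kernel X Y) : Prop :=
  IsMarkovKernel π ∧ Q.kl π ≠ ∞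

/-- The parameter set `Θ_i` of objective `i`: the parameters of norm at most `B` whose reward takes
values in `[0, B]` and has expectation `C` under the base policy. -/
def paramSet (Q : Model X Y m d) (i : Fin m) : Set (Vec d) :=
  {θ | ‖θ‖ ≤ Q.B ∧ (∀ x y, 0 ≤ Q.reward i θ x y ∧ Q.reward i θ x y ≤ Q.B) ∧
    Q.expect Q.piBase (Q.reward i θ) = Q.C}

/-- The vector `(𝔼_π[r_i^{θ_i} - β KL(π ‖ π_ref)])_i`. -/
def valueVec (Q : Model X Y m d) (θ : Fin m → Vec d) (π : Kernel X Y) : Vec m :=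
  WithLp.toLp 2 fun i => Q.expect π (Q.reward i (θ i)) - Q.β * (Q.kl π).toReal

/-- The expected reward vector `S(π)` for the true rewards. -/
def S (Q : Model X Y m d) (π : Kernel X Y) : Vec m := Q.valueVec Q.θstar π

/-- `D(π) = d(S(π), W)`. -/
def D (Q : Model X Y m d) (W : Set (Vec m)) (π : Kernel X Y) : ℝ :=
  Metric.infDist (Q.S π) W

/-- `π` minimizes `D` over all policies. -/
def IsOptimal (Q : Model X Y m d) (W : Set (Vec m)) (π : Kernel X Y) : Prop :=
  Q.IsPolicy π ∧ ∀ π', Q.IsPolicy π' → Q.D W π ≤ Q.D W π'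

/-! ### The algorithm -/

/-- `J(r^θ, e, π) = 𝔼_π[∑ i, e_i (r_i^{θ_i} - β KL(π ‖ π_ref))]`. -/
def J (Q : Model X Y m d) (θ : Fin m → Vec d) (e : Vec m) (π : Kernel X Y) : ℝ :=
  ∑ i, e i * (Q.expect π (Q.reward i (θ i)) - Q.β * (Q.kl π).toReal)

/-- `max_π J(r^θ, e, π)`. -/
def maxJ (Q : Model X Y m d) (θ : Fin m → Vec d) (e : Vec m) : ℝ :=
  sSup {a | ∃ π, Q.IsPolicy π ∧ a = Q.J θ e π}

/-- The negative log-likelihood of a list of comparisons `(x, y_w, y_l)`. -/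
def loss (Q : Model X Y m d) {M : ℕ} (i : Fin m) (data : Fin M → X × Y × Y) (θ : Vec d) : ℝ :=
  -∑ j, Real.log (Real.sigmoid
    (Q.reward i θ (data j).1 (data j).2.1 - Q.reward i θ (data j).1 (data j).2.2))

/-- The quantity that the pessimistic (offline) parameter estimate maximizes. -/
def offlineObjective (Q : Model X Y m d) {M : ℕ} (η : ℝ) (data : Fin m → Fin M → X × Y × Y)
    (e : Vec m) (θ : Fin m → Vec d) : ℝ :=
  -Q.maxJ θ e - ∑ i, η * Q.loss i (data i) (θ i)

/-- `θ` is a pessimistic estimate for the direction `e`. -/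
def IsOfflineEstimate (Q : Model X Y m d) {M : ℕ} (η : ℝ) (data : Fin m → Fin M → X × Y × Y)
    (e : Vec m) (θ : Fin m → Vec d) : Prop :=
  (∀ i, θ i ∈ Q.paramSet i) ∧
    ∀ θ' : Fin m → Vec d, (∀ i, θ' i ∈ Q.paramSet i) →
      Q.offlineObjective η data e θ' ≤ Q.offlineObjective η data e θ

/-- `π` maximizes `J(r^θ, e, ·)`. -/
def IsGreedy (Q : Model X Y m d) (θ : Fin m → Vec d) (e : Vec m) (π : Kernel X Y) : Prop :=
  Q.IsPolicy π ∧ ∀ π', Q.IsPolicy π' → Q.J θ e π' ≤ Q.J θ e π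

end Model

/-- The probability simplex in `ℝᵐ`. -/
def simplex (m : ℕ) : Set (Vec m) := {e | (∀ i, 0 ≤ e i) ∧ ∑ i, e i = 1}

/-- `w` is the metric projection of `v` to `W`. -/
def IsProj {m : ℕ} (W : Set (Vec m)) (v w : Vec m) : Prop :=
  w ∈ W ∧ ∀ z ∈ W, ‖w - v‖ ≤ ‖z - v‖

/-- The direction `(Π_W(v) - v) / ‖Π_W(v) - v‖`, given the projection `w = Π_W(v)`. -/
def projDir {m : ℕ} (v w : Vec m) : Vec m := ‖w - v‖⁻¹ • (w - v)

/-- `e` is a legitimate `ℓ¹`-normalized direction after the averaged reward vector `v`: it is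
`d / ‖d‖₁` with `d` the direction from `v` to its projection if `v ∉ W`, and any vector of
the simplex if `v ∈ W`, where that direction is undefined. -/
def IsNextDirection {m : ℕ} (W : Set (Vec m)) (v e : Vec m) : Prop :=
  (v ∈ W → e ∈ simplex m) ∧
  (v ∉ W → ∃ w, IsProj W v w ∧ e = (∑ i, |projDir v w i|)⁻¹ • projDir v w)

namespace Model

variable {X : Type u} {Y : Type v} [MeasurableSpace X] [MeasurableSpace Y] {m d : ℕ}

/-- The averaged reward vector `(1 / t) ∑_{j = 1}^t V^j`, where `V^j` is the value vector of the
`j`-th policy under the `j`-th estimate. -/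
def avgValue (Q : Model X Y m d) (θ : ℕ → Fin m → Vec d) (π : ℕ → Kernel X Y) (t : ℕ) : Vec m :=
  (t : ℝ)⁻¹ • ∑ j ∈ Finset.Icc 1 t, Q.valueVec (θ j) (π j)

/-- `(e, θ, π)` are the directions, estimates and policies, in rounds `1, …, T`, of a run of the
offline algorithm with target set `W`.  The first direction and all ties are arbitrary. -/
structure IsRun (Q : Model X Y m d) {M : ℕ} (W : Set (Vec m)) (η : ℝ)
    (data : Fin m → Fin M → X × Y × Y) (T : ℕ)
    (e : ℕ → Vec m) (θ : ℕ → Fin m → Vec d) (π : ℕ → Kernel X Y) : Prop where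
  init : e 1 ∈ simplex m
  estimate : ∀ t ∈ Finset.Icc 1 T, Q.IsOfflineEstimate η data (e t) (θ t)
  greedy : ∀ t ∈ Finset.Icc 1 T, Q.IsGreedy (θ t) (e t) (π t)
  direction : ∀ t ∈ Finset.Icc 1 T, t < T → IsNextDirection W (Q.avgValue θ π t) (e (t + 1))

end Model

/-- The averaged policy `(1 / T) ∑_{t = 1}^T π^t`. -/
def avgPolicy {X : Type u} {Y : Type v} [MeasurableSpace X] [MeasurableSpace Y] (T : ℕ)
    (π : ℕ → Kernel X Y) : Kernel X Y where
  toFun x := (T : ℝ≥0∞)⁻¹ • ∑ t ∈ Finset.Icc 1 T, π t x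
  measurable' := by
    refine Measure.measurable_of_measurable_coe _ fun s hs => ?_
    simp only [Measure.smul_apply, Measure.finsetSum_apply, smul_eq_mul]
    exact (Finset.measurable_sum _ fun t _ => (π t).measurable_coe hs).const_mul _

/-! ### The preference data -/

section Data

variable {X : Type u} {Y : Type v} [MeasurableSpace X] [MeasurableSpace Y] {M : ℕ}

/-- Given prompts with two responses `(x, y₁, y₂)`, and labels (`true` means `y₁ ≻ y₂`), the
resulting comparisons `(x, y_w, y_l)`. -/
def comparisons (q : Fin M → X × Y × Y) (lab : Fin M → Bool) (j : Fin M) : X × Y × Y :=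
  if lab j then q j else ((q j).1, (q j).2.2, (q j).2.1)

/-- The probability of a label in the Bradley-Terry model with reward `r`. -/
def btProb (r : X → Y → ℝ) (z : X × Y × Y) (b : Bool) : ℝ :=
  if b then Real.sigmoid (r z.1 z.2.1 - r z.1 z.2.2)
  else 1 - Real.sigmoid (r z.1 z.2.1 - r z.1 z.2.2)

/-- The `M` random prompts and response pairs `q` have an arbitrary joint law and, given all of
them, the labels are independent and follow the Bradley-Terry model with reward `r`. -/
structure IsBTSample {Ω : Type w} [MeasurableSpace Ω] (P : Measure Ω) (r : X → Y → ℝ)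
    (q : Ω → Fin M → X × Y × Y) (lab : Ω → Fin M → Bool) : Prop where
  measurable_q : Measurable q
  measurable_lab : Measurable lab
  label_law : ∀ b : Fin M → Bool,
    P⟦{ω | lab ω = b} | MeasurableSpace.comap q inferInstance⟧
      =ᵐ[P] fun ω => ∏ j, btProb r (q ω j) (b j)

/-- The empirical covariance matrix of the feature differences of the comparisons for
objective `i`. -/
def Model.empCov {m d : ℕ} (Q : Model X Y m d) (i : Fin m) (data : Fin M → X × Y × Y) :
    Matrix (Fin d) (Fin d) ℝ :=
  (M : ℝ)⁻¹ • ∑ j, Matrix.vecMulVec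
    (fun a => (Q.φ i (data j).1 (data j).2.1 - Q.φ i (data j).1 (data j).2.2) a)
    (fun a => (Q.φ i (data j).1 (data j).2.1 - Q.φ i (data j).1 (data j).2.2) a)

/-- The smallest eigenvalue of a real symmetric matrix. -/
def lambdaMin {d : ℕ} (A : Matrix (Fin d) (Fin d) ℝ) : ℝ := sInf (spectrum ℝ A)

end Data

end MOPO

end

noncomputable section

namespace MOPO

/-! The bound splits into a deterministic approachability estimate and a statistical estimate of the
parameters.

Approachability: the target `W` is convex and upward closed (`Group.convex_target`,
`Group.target_upward`). Upward closedness makes every projection direction nonnegative, so its `ℓ¹`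
normalization is an admissible weight vector. The greedy policy for that weight beats the optimal
policy, up to the error `ε` of the estimated parameters, so the vectors `V t` satisfy Blackwell's
condition for the neighbourhood of `W` of radius `D(π*) + ε`. Their averages approach it at rate `2
B √m / √T` (`infDist_runningAverage_le`). Convexity of the divergence makes the value of the
averaged policy dominate the average of the true values, which costs a second `ε`
(`Model.IsRun.D_avgPolicy_le`).

Statistics: the logistic loss has curvature of order `exp (-B')` times the empirical covariance.
`maxJ` is Lipschitz in the parameters, so comparing an estimate with the truth bounds its excess
loss by `√M` times the sum of the parameter errors. The linear term of the loss is controlled by the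
score at the truth, and a quadratic inequality for the error results
(`Model.IsOfflineEstimate.sqrt_sum_le`). The trivial bound `2 B'` on each error supplies the
regularization `1 / M` of the smallest eigenvalue.

Probability enters only through the scores at the true parameters: given the prompts they are sums
of independent centered terms, and Hoeffding's inequality with a union bound over all coordinates
controls them (`Model.measure_score_gt_le`). This event does not depend on the run, so the bound
holds for all runs at once. -/

/-! ### Target sets: monotonicity and convexity. -/

theorem Group.exists_pos_weight {m : ℕ} (g : Group m) : ∃ i, 0 < g.α i := by
  by_contra! h
  have h0 : ∑ i, g.α i ≤ 0 := Finset.sum_nonpos fun i _ => h i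
  linarith [g.α_sum]

theorem sum_mul_rpow_pos {m : ℕ} {α : Fin m → ℝ} (hα : ∀ i, 0 ≤ α i) {i₀ : Fin m} (h₀ : 0 < α i₀)
    {p : ℝ} {z : Fin m → ℝ} (hz : ∀ i, 0 ≤ z i) (hpos : ∀ i, 0 < α i → 0 < z i) :
    0 < ∑ i, α i * z i ^ p :=
  Finset.sum_pos' (fun i _ => mul_nonneg (hα i) (Real.rpow_nonneg (hz i) p))
    ⟨i₀, Finset.mem_univ _, mul_pos h₀ (Real.rpow_pos_of_pos (hpos i₀ h₀) p)⟩

/-- Positive superlevel sets of the weighted `p`-mean. -/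
theorem Group.le_pMean_iff {m : ℕ} (g : Group m) {c : ℝ} (hc : 0 < c) {z : Fin m → ℝ}
    (hz : ∀ i, 0 ≤ z i) :
    c ≤ pMean g.α g.p z ↔
      (g.p = ⊥ ∧ ∀ i, c ≤ z i) ∨
      (g.p = ((0 : ℝ) : WithBot ℝ) ∧ c ≤ ∏ i, z i ^ g.α i) ∨
      ∃ p : ℝ, g.p = (p : WithBot ℝ) ∧
        ((p < 0 ∧ (∀ i, 0 < g.α i → 0 < z i) ∧ ∑ i, g.α i * z i ^ p ≤ c ^ p) ∨
          (0 < p ∧ c ^ p ≤ ∑ i, g.α i * z i ^ p)) := by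
  obtain ⟨i₀, hi₀⟩ := g.exists_pos_weight
  have : Nonempty (Fin m) := ⟨i₀⟩
  obtain hp | ⟨p, hp⟩ : g.p = ⊥ ∨ ∃ p : ℝ, g.p = (p : WithBot ℝ) := by
    induction g.p using WithBot.recBotCoe <;> simp
  · have h1 : pMean g.α ⊥ z = ⨅ i, z i := rfl
    rw [hp, h1, le_ciInf_iff (Set.finite_range z).bddBelow]
    simp
  · have h1 : pMean g.α (p : WithBot ℝ) z = if p = 0 then ∏ i, z i ^ g.α i
      else if p < 0 ∧ ∃ i, 0 < g.α i ∧ z i = 0 then 0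
      else (∑ i, g.α i * z i ^ p) ^ (1 / p) := rfl
    rw [hp, h1]
    simp only [WithBot.coe_ne_bot, WithBot.coe_inj, false_and, false_or, exists_eq_left']
    rcases lt_trichotomy p 0 with hneg | rfl | hpos
    · have hne : p ≠ 0 := hneg.ne
      simp only [hne, hneg, if_false, false_and, false_or, true_and, hneg.not_gt, or_false]
      by_cases hex : ∃ i, 0 < g.α i ∧ z i = 0
      · rw [if_pos hex]
        obtain ⟨i, hi, hi'⟩ := hex
        constructor
        · intro h; linarith
        · rintro ⟨h, _⟩; exact absurd (h i hi) (by simp [hi'])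
      · rw [if_neg hex]
        have hpz : ∀ i, 0 < g.α i → 0 < z i := fun i hi =>
          lt_of_le_of_ne (hz i) fun h => hex ⟨i, hi, h.symm⟩
        -- For `p < 0` the outer power `1 / p` is decreasing on the positive reals, so removing it
        -- reverses the inequality; a positive weight keeps the sum positive.
        have hs := sum_mul_rpow_pos g.α_nonneg hi₀ (p := p) hz hpz
        rw [one_div, Real.le_rpow_inv_iff_of_neg hc hs hneg]
        exact ⟨fun h => ⟨hpz, h⟩, fun h => h.2⟩
    · simp
    · have hne : p ≠ 0 := hpos.ne'
      simp only [hne, hpos, if_false, false_and, false_or, true_and, hpos.not_gt]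
      have hs : 0 ≤ ∑ i, g.α i * z i ^ p := Finset.sum_nonneg fun i _ =>
        mul_nonneg (g.α_nonneg i) (Real.rpow_nonneg (hz i) p)
      rw [one_div, Real.le_rpow_inv_iff_of_pos hc.le hs hpos]

theorem pMean_nonneg {m : ℕ} {α : Fin m → ℝ} (hα : ∀ i, 0 ≤ α i) (p : WithBot ℝ)
    {z : Fin m → ℝ} (hz : ∀ i, 0 ≤ z i) : 0 ≤ pMean α p z := by
  rcases p with _ | p
  · exact Real.iInf_nonneg hz
  · simp only [pMean]
    split_ifs
    · exact Finset.prod_nonneg fun i _ => Real.rpow_nonneg (hz i) _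
    · exact le_rfl
    · exact Real.rpow_nonneg (Finset.sum_nonneg fun i _ =>
        mul_nonneg (hα i) (Real.rpow_nonneg (hz i) p)) _

/-- A threshold `c ≤ 0` asks only for nonnegativity. For `c > 0`, `le_pMean_iff` removes the outer
exponent and leaves termwise monotonicity. -/
theorem Group.target_upward {m : ℕ} (g : Group m) {z z' : Vec m} (hz : z ∈ g.target)
    (h : ∀ i, z i ≤ z' i) : z' ∈ g.target := by
  obtain ⟨h0, hc⟩ := hz
  have h0' : ∀ i, 0 ≤ z' i := fun i => (h0 i).trans (h i)
  refine ⟨h0', ?_⟩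
  rcases le_or_gt g.c 0 with hc0 | hc0
  · exact hc0.trans (pMean_nonneg g.α_nonneg _ h0')
  rw [g.le_pMean_iff hc0 h0] at hc
  rw [g.le_pMean_iff hc0 h0']
  rcases hc with ⟨hp, h1⟩ | ⟨hp, h1⟩ | ⟨p, hp, ⟨hneg, hpz, h1⟩ | ⟨hpos, h1⟩⟩
  · exact Or.inl ⟨hp, fun i => (h1 i).trans (h i)⟩
  · exact Or.inr (Or.inl ⟨hp, h1.trans (Finset.prod_le_prod
      (fun i _ => Real.rpow_nonneg (h0 i) _)
      fun i _ => Real.rpow_le_rpow (h0 i) (h i) (g.α_nonneg i))⟩)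
  · refine Or.inr (Or.inr ⟨p, hp, Or.inl ⟨hneg, fun i hi => (hpz i hi).trans_le (h i), ?_⟩⟩)
    refine le_trans (Finset.sum_le_sum fun i _ => ?_) h1
    -- A coordinate of weight zero may vanish, where the default value `0 ^ p = 0` breaks
    -- antitonicity; its term is zero anyway.
    rcases (g.α_nonneg i).eq_or_lt with hi | hi
    · simp [← hi]
    · exact mul_le_mul_of_nonneg_left
        (Real.rpow_le_rpow_of_nonpos (hpz i hi) (h i) hneg.le) hi.le
  · exact Or.inr (Or.inr ⟨p, hp, Or.inr ⟨hpos, h1.trans (Finset.sum_le_sum fun i _ =>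
      mul_le_mul_of_nonneg_left (Real.rpow_le_rpow (h0 i) (h i) hpos.le) (g.α_nonneg i))⟩⟩)

/-- The weighted AM-GM inequality is applied twice: to the bases, where the power reverses it, and
then to the powers. -/
theorem convexOn_rpow_of_neg {p : ℝ} (hp : p < 0) :
    ConvexOn ℝ (Set.Ioi 0) fun x : ℝ => x ^ p := by
  refine ⟨convex_Ioi 0, fun x (hx : 0 < x) y (hy : 0 < y) a b ha hb hab => ?_⟩
  simp only [smul_eq_mul]
  calc (a * x + b * y) ^ p ≤ (x ^ a * y ^ b) ^ p :=
        Real.rpow_le_rpow_of_nonpos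
          (mul_pos (Real.rpow_pos_of_pos hx a) (Real.rpow_pos_of_pos hy b))
          (Real.geom_mean_le_arith_mean2_weighted ha hb hx.le hy.le hab) hp.le
    _ = (x ^ p) ^ a * (y ^ p) ^ b := by
        rw [Real.mul_rpow (Real.rpow_nonneg hx.le _) (Real.rpow_nonneg hy.le _),
          ← Real.rpow_mul hx.le, ← Real.rpow_mul hy.le, ← Real.rpow_mul hx.le,
          ← Real.rpow_mul hy.le, mul_comm a, mul_comm b]
    _ ≤ _ := Real.geom_mean_le_arith_mean2_weighted ha hb (Real.rpow_nonneg hx.le _)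
        (Real.rpow_nonneg hy.le _) hab

/-- The weighted geometric mean is log-concave. -/
theorem prod_rpow_le_of_convex {m : ℕ} {α : Fin m → ℝ} (hα : ∀ i, 0 ≤ α i)
    {c : ℝ} (hc : 0 < c) {x y : Fin m → ℝ} (hx : ∀ i, 0 ≤ x i)
    (hy : ∀ i, 0 ≤ y i) (hcx : c ≤ ∏ i, x i ^ α i) (hcy : c ≤ ∏ i, y i ^ α i) {a b : ℝ}
    (ha : 0 ≤ a) (hb : 0 ≤ b) (hab : a + b = 1) :
    c ≤ ∏ i, (a * x i + b * y i) ^ α i := by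
  have key : ∏ i, (x i ^ α i) ^ a * (y i ^ α i) ^ b ≤ ∏ i, (a * x i + b * y i) ^ α i := by
    refine Finset.prod_le_prod (fun i _ => mul_nonneg (Real.rpow_nonneg
      (Real.rpow_nonneg (hx i) _) _) (Real.rpow_nonneg (Real.rpow_nonneg (hy i) _) _))
      fun i _ => ?_
    have h := Real.geom_mean_le_arith_mean2_weighted ha hb (hx i) (hy i) hab
    rw [← Real.rpow_mul (hx i), ← Real.rpow_mul (hy i), mul_comm (α i) a, mul_comm (α i) b,
      Real.rpow_mul (hx i), Real.rpow_mul (hy i),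
      ← Real.mul_rpow (Real.rpow_nonneg (hx i) _) (Real.rpow_nonneg (hy i) _)]
    exact Real.rpow_le_rpow (mul_nonneg (Real.rpow_nonneg (hx i) _)
      (Real.rpow_nonneg (hy i) _)) h (hα i)
  refine le_trans ?_ key
  rw [Finset.prod_mul_distrib, Real.finsetProd_rpow _ _ fun i _ => Real.rpow_nonneg (hx i) _,
    Real.finsetProd_rpow _ _ fun i _ => Real.rpow_nonneg (hy i) _]
  calc c = c ^ a * c ^ b := by rw [← Real.rpow_add hc, hab, Real.rpow_one]
    _ ≤ _ := mul_le_mul (Real.rpow_le_rpow hc.le hcx ha) (Real.rpow_le_rpow hc.le hcy hb)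
      (Real.rpow_nonneg hc.le _) (Real.rpow_nonneg (hc.le.trans hcx) _)

/-- With the outer exponent removed, a positive threshold gives a sublevel set of a convex function
for `p < 0`, and a superlevel set of a concave one for `0 < p ≤ 1`. The case `p = 0` is
log-concavity, and `p = ⊥` is coordinatewise. -/
theorem Group.convex_target {m : ℕ} (g : Group m) : Convex ℝ g.target := by
  intro x hx y hy a b ha hb hab
  have h0 : ∀ i, 0 ≤ (a • x + b • y) i := fun i => by
    simpa using add_nonneg (mul_nonneg ha (hx.1 i)) (mul_nonneg hb (hy.1 i))
  refine ⟨h0, ?_⟩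
  rcases le_or_gt g.c 0 with hc0 | hc0
  · exact hc0.trans (pMean_nonneg g.α_nonneg _ h0)
  have hx' := (g.le_pMean_iff hc0 hx.1).1 hx.2
  have hy' := (g.le_pMean_iff hc0 hy.1).1 hy.2
  rw [g.le_pMean_iff hc0 h0]
  simp only [PiLp.add_apply, PiLp.smul_apply, smul_eq_mul]
  rcases hx' with ⟨hp, h1⟩ | ⟨hp, h1⟩ | ⟨p, hp, hx'⟩
  · simp only [hp, true_and, WithBot.bot_ne_coe, false_and, exists_false, or_false] at hy'
    refine Or.inl ⟨hp, fun i => ?_⟩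
    calc g.c = a * g.c + b * g.c := by rw [← add_mul, hab, one_mul]
      _ ≤ _ := add_le_add (mul_le_mul_of_nonneg_left (h1 i) ha)
        (mul_le_mul_of_nonneg_left (hy' i) hb)
  · simp only [hp, WithBot.coe_ne_bot, true_and, false_and, false_or, WithBot.coe_inj,
      exists_eq_left', lt_irrefl, or_false] at hy'
    exact Or.inr (Or.inl ⟨hp, prod_rpow_le_of_convex g.α_nonneg hc0 hx.1 hy.1 h1 hy'
      ha hb hab⟩)
  · have hp1 : p ≤ 1 := by
      have := g.p_le_one
      rw [hp] at this
      exact WithBot.coe_le_coe.1 this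
    have hp0 : p ≠ 0 := by
      rintro rfl
      simp at hx'
    simp only [hp, WithBot.coe_ne_bot, false_and, false_or, WithBot.coe_inj, hp0,
      exists_eq_left'] at hy'
    refine Or.inr (Or.inr ⟨p, hp, ?_⟩)
    rcases hx' with ⟨hneg, hpx, hx1⟩ | ⟨hpos, hx1⟩
    · simp only [hneg, true_and, hneg.not_gt, false_and, or_false] at hy'
      obtain ⟨hpy, hy1⟩ := hy'
      refine Or.inl ⟨hneg, fun i hi => ?_, ?_⟩
      · exact (convex_Ioi (0 : ℝ)) (hpx i hi) (hpy i hi) ha hb hab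
      · calc ∑ i, g.α i * (a * x i + b * y i) ^ p
            ≤ ∑ i, (a * (g.α i * x i ^ p) + b * (g.α i * y i ^ p)) := by
              refine Finset.sum_le_sum fun i _ => ?_
              rcases (g.α_nonneg i).eq_or_lt with hi | hi
              · simp [← hi]
              · have h := (convexOn_rpow_of_neg hneg).2 (hpx i hi) (hpy i hi) ha hb hab
                simp only [smul_eq_mul] at h
                nlinarith
          _ = a * ∑ i, g.α i * x i ^ p + b * ∑ i, g.α i * y i ^ p := by
              rw [Finset.sum_add_distrib, Finset.mul_sum, Finset.mul_sum]
          _ ≤ a * g.c ^ p + b * g.c ^ p := add_le_add (mul_le_mul_of_nonneg_left hx1 ha)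
              (mul_le_mul_of_nonneg_left hy1 hb)
          _ = g.c ^ p := by rw [← add_mul, hab, one_mul]
    · simp only [hpos, true_and, hpos.not_gt, false_and, false_or] at hy'
      refine Or.inr ⟨hpos, ?_⟩
      calc g.c ^ p = a * g.c ^ p + b * g.c ^ p := by rw [← add_mul, hab, one_mul]
        _ ≤ a * ∑ i, g.α i * x i ^ p + b * ∑ i, g.α i * y i ^ p :=
          add_le_add (mul_le_mul_of_nonneg_left hx1 ha) (mul_le_mul_of_nonneg_left hy' hb)
        _ = ∑ i, (a * (g.α i * x i ^ p) + b * (g.α i * y i ^ p)) := by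
          rw [Finset.sum_add_distrib, Finset.mul_sum, Finset.mul_sum]
        _ ≤ _ := by
          refine Finset.sum_le_sum fun i _ => ?_
          have h := (Real.concaveOn_rpow hpos.le hp1).2 (hx.1 i) (hy.1 i) ha hb hab
          simp only [smul_eq_mul] at h
          nlinarith [g.α_nonneg i]

theorem convex_consensusTarget {m N : ℕ} (g : Fin N → Group m) :
    Convex ℝ (consensusTarget g) :=
  convex_iInter fun n => (g n).convex_target

theorem consensusTarget_upward {m N : ℕ} (g : Fin N → Group m) {z z' : Vec m}
    (hz : z ∈ consensusTarget g) (h : ∀ i, z i ≤ z' i) : z' ∈ consensusTarget g :=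
  Set.mem_iInter.2 fun n => (g n).target_upward (Set.mem_iInter.1 hz n) h

/-! ### Projections and Blackwell approachability. -/

section

variable {m : ℕ} {W : Set (Vec m)}

/-- The distance to an upward closed set is antitone. -/
theorem infDist_le_of_le (hW : ∀ z ∈ W, ∀ z' : Vec m, (∀ i, z i ≤ z' i) → z' ∈ W)
    {v v' : Vec m} (h : ∀ i, v i ≤ v' i) : Metric.infDist v' W ≤ Metric.infDist v W := by
  rcases W.eq_empty_or_nonempty with rfl | hne
  · simp
  refine (Metric.le_infDist hne).2 fun z hz => ?_
  have hz' : z + (v' - v) ∈ W := hW z hz _ fun i => by simpa using h i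
  calc Metric.infDist v' W ≤ dist v' (z + (v' - v)) := Metric.infDist_le_dist_of_mem hz'
    _ = dist v z := by
      rw [dist_eq_norm, dist_eq_norm]; congr 1; abel

theorem IsProj.inner_le (hW : Convex ℝ W) {v w : Vec m} (h : IsProj W v w) {z : Vec m}
    (hz : z ∈ W) : 0 ≤ inner ℝ (w - v) (z - w) := by
  have h1 : ‖v - w‖ = ⨅ x : W, ‖v - x‖ := by
    have : Nonempty W := ⟨⟨w, h.1⟩⟩
    refine le_antisymm (le_ciInf fun x => ?_)
      (ciInf_le ⟨0, by rintro _ ⟨x, rfl⟩; exact norm_nonneg _⟩ (⟨w, h.1⟩ : W))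
    rw [norm_sub_rev v w, norm_sub_rev v]
    exact h.2 x x.2
  have h2 := (norm_eq_iInf_iff_real_inner_le_zero hW h.1).1 h1 z hz
  have h3 : w - v = -(v - w) := by abel
  rw [h3, inner_neg_left]
  linarith

theorem IsProj.infDist_eq {v w : Vec m} (h : IsProj W v w) :
    Metric.infDist v W = ‖w - v‖ := by
  refine le_antisymm ?_ ((Metric.le_infDist ⟨w, h.1⟩).2 fun z hz => ?_)
  · rw [norm_sub_rev, ← dist_eq_norm]; exact Metric.infDist_le_dist_of_mem h.1
  · rw [dist_eq_norm, norm_sub_rev v]; exact h.2 z hz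

/-- The projection to an upward closed set increases every coordinate. -/
theorem IsProj.le (hW : Convex ℝ W) (hW' : ∀ z ∈ W, ∀ z' : Vec m, (∀ i, z i ≤ z' i) → z' ∈ W)
    {v w : Vec m} (h : IsProj W v w) (i : Fin m) : v i ≤ w i := by
  -- Testing the variational inequality of the projection one unit above `w` in coordinate `i`
  -- isolates `w i - v i`.
  have hz : w + EuclideanSpace.single i 1 ∈ W := hW' w h.1 _ fun j => by
    by_cases hj : j = i <;> simp [hj]
  have := h.inner_le hW hz
  simpa [EuclideanSpace.inner_single_right] using this

theorem IsNextDirection.mem_simplex (hW : Convex ℝ W)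
    (hW' : ∀ z ∈ W, ∀ z' : Vec m, (∀ i, z i ≤ z' i) → z' ∈ W)
    {v e : Vec m} (h : IsNextDirection W v e) : e ∈ simplex m := by
  by_cases hv : v ∈ W
  · exact h.1 hv
  obtain ⟨w, hw, rfl⟩ := h.2 hv
  have h0 : ∀ i, 0 ≤ projDir v w i := fun i => by
    simpa [projDir] using mul_nonneg (inv_nonneg.2 (norm_nonneg (w - v)))
      (sub_nonneg.2 (hw.le hW hW' i))
  refine ⟨fun i => ?_, ?_⟩
  · simpa using mul_nonneg (inv_nonneg.2 (Finset.sum_nonneg fun j _ => abs_nonneg _)) (h0 i)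
  · simp only [PiLp.smul_apply, smul_eq_mul, ← Finset.mul_sum]
    simp only [abs_of_nonneg (h0 _)]
    refine inv_mul_cancel₀ fun hs => ?_
    rw [Finset.sum_eq_zero_iff_of_nonneg fun i _ => h0 i] at hs
    have hne : w - v ≠ 0 := sub_ne_zero.2 fun h => hv (h ▸ hw.1)
    have hp : projDir v w ≠ 0 := smul_ne_zero (inv_ne_zero (norm_ne_zero_iff.2 hne)) hne
    exact hp (by ext i; simpa using hs i (Finset.mem_univ i))

/-- One step of approachability: if `V` is not worse than the point `s` in the direction `e` of
the projection, up to an error `ε`, then the projection `w` of `v` satisfies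
`⟨d, w - V⟩ ≤ d(s, W) + ε`, with `d` the unit direction from `v` to `w`. -/
theorem inner_projDir_le (hW : Convex ℝ W) {v w V s : Vec m} (hw : IsProj W v w) (hne : w ≠ v)
    {e : Vec m} (he : e = (∑ i, |projDir v w i|)⁻¹ • projDir v w)
    {ε : ℝ} {Δ : Fin m → ℝ} (hΔ : √(∑ i, Δ i ^ 2) ≤ ε)
    (hV : ∑ i, e i * s i - ∑ i, e i * Δ i ≤ ∑ i, e i * V i) :
    inner ℝ (w - v) (w - V) ≤ ‖w - v‖ * (Metric.infDist s W + ε) := by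
  have hn : 0 < ‖w - v‖ := norm_pos_iff.2 (sub_ne_zero.2 hne)
  have hc : 0 < (∑ i, |projDir v w i|)⁻¹ := by
    refine inv_pos.2 (lt_of_le_of_ne (Finset.sum_nonneg fun j _ => abs_nonneg _) fun hs => ?_)
    have hs := hs.symm
    rw [Finset.sum_eq_zero_iff_of_nonneg fun i _ => abs_nonneg _] at hs
    have hp : projDir v w ≠ 0 := smul_ne_zero (inv_ne_zero hn.ne') (sub_ne_zero.2 hne)
    exact hp (by ext i; simpa using hs i (Finset.mem_univ i))
  -- Since `e` is a positive multiple of `w - v`, both normalizations cancel from the inequality.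
  have hV' : ∑ i, (w i - v i) * s i - ∑ i, (w i - v i) * Δ i ≤ ∑ i, (w i - v i) * V i := by
    have e1 : ∀ f : Fin m → ℝ, ∑ i, e i * f i
        = ((∑ i, |projDir v w i|)⁻¹ * ‖w - v‖⁻¹) * ∑ i, (w i - v i) * f i := fun f => by
      rw [Finset.mul_sum]
      refine Finset.sum_congr rfl fun i _ => ?_
      simp only [he, projDir, PiLp.smul_apply, PiLp.sub_apply, smul_eq_mul]
      ring
    rw [e1 (fun i => s i), e1 Δ, e1 (fun i => V i), ← mul_sub] at hV
    exact le_of_mul_le_mul_left hV (mul_pos hc (inv_pos.2 hn))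
  have hi : ∀ u : Vec m, inner ℝ (w - v) u = ∑ i, (w i - v i) * u i := fun u => by
    simp [PiLp.inner_apply, mul_comm]
  have hCS : ∑ i, (w i - v i) * Δ i ≤ ‖w - v‖ * ε := by
    have h1 := real_inner_le_norm (w - v) (WithLp.toLp 2 Δ)
    rw [hi] at h1
    have h2 : ‖WithLp.toLp 2 Δ‖ = √(∑ i, Δ i ^ 2) := by
      simp [EuclideanSpace.norm_eq]
    rw [h2] at h1
    exact h1.trans (mul_le_mul_of_nonneg_left hΔ hn.le)
  rw [← hi s, ← hi V] at hV'
  -- For each `z ∈ W` the projection inequality allows `w` to be replaced by `z`; Cauchy-Schwarz and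
  -- the infimum over `z` finish.
  have hs : inner ℝ (w - v) (w - s) ≤ ‖w - v‖ * Metric.infDist s W := by
    have : inner ℝ (w - v) (w - s) / ‖w - v‖ ≤ Metric.infDist s W := by
      refine (Metric.le_infDist ⟨w, hw.1⟩).2 fun z hz => ?_
      rw [div_le_iff₀ hn]
      have h1 := hw.inner_le hW hz
      have h2 := real_inner_le_norm (w - v) (z - s)
      have h3 : w - s = (z - s) - (z - w) := by abel
      rw [h3, inner_sub_right, dist_comm, dist_eq_norm, mul_comm]
      linarith
    rw [div_le_iff₀ hn] at this
    linarith
  rw [inner_sub_right] at hs ⊢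
  linarith [hV', hs, hCS]

/-- The squared excess distance decreases along an averaging step. -/
theorem sq_excess_step {v w V : Vec m} (hw : IsProj W v w) {r K : ℝ} (hr : 0 ≤ r)
    (hgt : r < Metric.infDist v W)
    (hin : inner ℝ (w - v) (w - V) ≤ ‖w - v‖ * r) (hK : ‖V - v‖ ≤ K) {t : ℝ} (ht : 1 ≤ t)
    (hE : (Metric.infDist v W - r) ^ 2 ≤ K ^ 2 / t) {v' : Vec m}
    (hv' : v' = v + (t + 1)⁻¹ • (V - v)) :
    Metric.infDist v' W ≤ r + √(K ^ 2 / (t + 1)) := by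
  have ht0 : 0 < t := by linarith
  rw [hw.infDist_eq] at hgt hE
  have hn : 0 < ‖w - v‖ := hr.trans_lt hgt
  -- The point at distance `r` from `w` towards `v`. It plays the role of the projection of `v` to
  -- the `r`-neighbourhood of `W`, so that `‖w' - v‖` is the excess distance.
  set w' : Vec m := w - (r / ‖w - v‖) • (w - v) with hw'
  have hww' : ‖w' - w‖ = r := by
    rw [hw', sub_sub_cancel_left, norm_neg, norm_smul, Real.norm_of_nonneg (by positivity)]
    field_simp
  have hw'v : w' - v = (1 - r / ‖w - v‖) • (w - v) := by
    rw [hw', sub_smul, one_smul]; abel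
  have hfac : 0 < 1 - r / ‖w - v‖ := by
    rw [sub_pos, div_lt_one hn]; exact hgt
  have hE' : ‖w' - v‖ = ‖w - v‖ - r := by
    rw [hw'v, norm_smul, Real.norm_of_nonneg hfac.le]
    field_simp
  have hin' : inner ℝ (w' - v) (w' - V) ≤ 0 := by
    have h1 : inner ℝ (w - v) (w' - V) ≤ 0 := by
      have h2 : w' - V = (w - V) - (r / ‖w - v‖) • (w - v) := by rw [hw']; abel
      rw [h2, inner_sub_right, inner_smul_right, real_inner_self_eq_norm_sq]
      have : r / ‖w - v‖ * ‖w - v‖ ^ 2 = ‖w - v‖ * r := by field_simp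
      linarith
    rw [hw'v, inner_smul_left]
    exact mul_nonpos_of_nonneg_of_nonpos hfac.le h1
  have hdist : Metric.infDist v' W ≤ r + ‖v' - w'‖ := by
    calc Metric.infDist v' W ≤ dist v' w := Metric.infDist_le_dist_of_mem hw.1
      _ ≤ dist v' w' + dist w' w := dist_triangle _ _ _
      _ = r + ‖v' - w'‖ := by rw [dist_eq_norm, dist_eq_norm, hww', add_comm]
  have hsq : ‖v' - w'‖ ^ 2 ≤ K ^ 2 / (t + 1) := by
    have h1 : v' - w' = (t + 1)⁻¹ • (V - v) - (w' - v) := by rw [hv']; abel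
    have h2 : inner ℝ (V - v) (w' - v) = ‖w' - v‖ ^ 2 - inner ℝ (w' - v) (w' - V) := by
      have : V - v = (w' - v) - (w' - V) := by abel
      rw [this, inner_sub_left, real_inner_self_eq_norm_sq, real_inner_comm]
    rw [h1, norm_sub_sq_real, inner_smul_left, norm_smul,
      Real.norm_of_nonneg (by positivity), h2]
    simp only [conj_trivial]
    have h3 : ‖V - v‖ ^ 2 ≤ K ^ 2 := pow_le_pow_left₀ (norm_nonneg _) hK 2
    rw [← hE'] at hE
    set s := (t + 1)⁻¹ with hs
    have hs0 : 0 < s := by positivity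
    have hs2 : s ≤ 1 / 2 := by
      rw [hs, inv_eq_one_div]; exact one_div_le_one_div_of_le (by norm_num) (by linarith)
    have h4 : (1 - 2 * s) * ‖w' - v‖ ^ 2 ≤ (1 - 2 * s) * (K ^ 2 / t) :=
      mul_le_mul_of_nonneg_left hE (by linarith)
    -- With `s = 1 / (t + 1)` the rate `K ^ 2 / t` reproduces itself, with slack `K ^ 2 / (t * (t +
    -- 1) ^ 2)`.
    have h5 : (1 - 2 * s) * (K ^ 2 / t) + s ^ 2 * K ^ 2 ≤ K ^ 2 / (t + 1) := by
      have : K ^ 2 / (t + 1) - ((1 - 2 * s) * (K ^ 2 / t) + s ^ 2 * K ^ 2)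
          = K ^ 2 / (t * (t + 1) ^ 2) := by
        rw [hs]; field_simp; ring
      have h6 : 0 ≤ K ^ 2 / (t * (t + 1) ^ 2) := by positivity
      linarith
    have h7 : (s * ‖V - v‖) ^ 2 ≤ s ^ 2 * K ^ 2 := by
      rw [mul_pow]; exact mul_le_mul_of_nonneg_left h3 (by positivity)
    have h8 : s * inner ℝ (w' - v) (w' - V) ≤ 0 :=
      mul_nonpos_of_nonneg_of_nonpos hs0.le hin'
    nlinarith
  exact hdist.trans (by
    have := Real.le_sqrt_of_sq_le hsq
    linarith)

/-- The average of the first `t` terms of a sequence indexed from `1`. -/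
def runningAverage (V : ℕ → Vec m) (t : ℕ) : Vec m := (t : ℝ)⁻¹ • ∑ j ∈ Finset.Icc 1 t, V j

theorem runningAverage_succ (V : ℕ → Vec m) {t : ℕ} (ht : 1 ≤ t) :
    runningAverage V (t + 1) = runningAverage V t
      + ((t : ℝ) + 1)⁻¹ • (V (t + 1) - runningAverage V t) := by
  have ht0 : (t : ℝ) ≠ 0 := by positivity
  have ht1 : (t : ℝ) + 1 ≠ 0 := by positivity
  ext i
  simp only [runningAverage, Finset.sum_Icc_succ_top (show 1 ≤ t + 1 by omega), Nat.cast_add,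
    Nat.cast_one, PiLp.smul_apply, PiLp.add_apply, PiLp.sub_apply, smul_eq_mul]
  field_simp
  ring

theorem abs_runningAverage_le {V : ℕ → Vec m} {B : ℝ} {t : ℕ} (ht : 1 ≤ t) {i : Fin m}
    (hV : ∀ j ∈ Finset.Icc 1 t, |V j i| ≤ B) : |runningAverage V t i| ≤ B := by
  have ht0 : (0 : ℝ) < t := by positivity
  simp only [runningAverage, PiLp.smul_apply, WithLp.ofLp_sum, Finset.sum_apply, smul_eq_mul]
  rw [abs_mul, abs_of_pos (inv_pos.2 ht0), inv_mul_le_iff₀ ht0]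
  calc |∑ j ∈ Finset.Icc 1 t, V j i| ≤ ∑ j ∈ Finset.Icc 1 t, |V j i| :=
        Finset.abs_sum_le_sum_abs _ _
    _ ≤ ∑ j ∈ Finset.Icc 1 t, B := Finset.sum_le_sum hV
    _ = t * B := by simp

theorem norm_le_sqrt_mul {v : Vec m} {b : ℝ} (hb : 0 ≤ b) (h : ∀ i, |v i| ≤ b) :
    ‖v‖ ≤ b * √(m : ℝ) := by
  rw [EuclideanSpace.norm_eq, ← Real.sqrt_sq hb, ← Real.sqrt_mul (sq_nonneg b)]
  refine Real.sqrt_le_sqrt ?_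
  calc ∑ i, ‖v i‖ ^ 2 ≤ ∑ _i : Fin m, b ^ 2 :=
        Finset.sum_le_sum fun i _ => pow_le_pow_left₀ (norm_nonneg _) (h i) 2
    _ = b ^ 2 * m := by simp [mul_comm]

/-- Approachability of a convex upward closed set up to the distance of the point `s`, by
responses to projection directions that are as good as `s` up to errors `Δ`. -/
theorem infDist_runningAverage_le (hW : Convex ℝ W)
    (hW' : ∀ z ∈ W, ∀ z' : Vec m, (∀ i, z i ≤ z' i) → z' ∈ W) {V e : ℕ → Vec m} {s : Vec m}
    {Δ : ℕ → Fin m → ℝ} {ε B : ℝ} {T : ℕ} (hT : 1 ≤ T) (hB : 0 ≤ B) (hε : 0 ≤ ε)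
    (hdir : ∀ t ∈ Finset.Icc 1 T, t < T → IsNextDirection W (runningAverage V t) (e (t + 1)))
    (hΔ : ∀ t ∈ Finset.Icc 1 T, √(∑ i, Δ t i ^ 2) ≤ ε)
    (hV : ∀ t ∈ Finset.Icc 1 T,
      ∑ i, e t i * s i - ∑ i, e t i * Δ t i ≤ ∑ i, e t i * V t i)
    (hVB : ∀ t ∈ Finset.Icc 1 T, ∀ i, |V t i| ≤ B) (hs : ∀ i, s i ≤ B) :
    Metric.infDist (runningAverage V T) W
      ≤ Metric.infDist s W + ε + 2 * (B * √(m : ℝ) / √(T : ℝ)) := by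
  set K : ℝ := 2 * B * √(m : ℝ) with hK
  have hK0 : 0 ≤ K := by positivity
  set r := Metric.infDist s W + ε with hr
  have hr0 : 0 ≤ r := add_nonneg Metric.infDist_nonneg hε
  have hdiff : ∀ v v' : Vec m, (∀ i, |v i| ≤ B) → (∀ i, |v' i| ≤ B) → ‖v - v'‖ ≤ K :=
    fun v v' h h' => norm_le_sqrt_mul (by positivity) fun i => by
      have h1 := abs_sub (v i) (v' i)
      simp only [PiLp.sub_apply]
      linarith [h i, h' i]
  have key : ∀ t : ℕ, 1 ≤ t → t ≤ T →
      Metric.infDist (runningAverage V t) W ≤ r + √(K ^ 2 / t) := by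
    intro t ht
    induction t, ht using Nat.le_induction with
    | base =>
      intro h1
      have h2 : runningAverage V 1 = V 1 := by simp [runningAverage]
      -- The constant vector `B` dominates `s`, hence is no farther from `W`. It stands in for `s`,
      -- which has no lower bound, in the comparison with `V 1`.
      have hb : Metric.infDist (WithLp.toLp 2 fun _ => B : Vec m) W ≤ Metric.infDist s W :=
        infDist_le_of_le hW' fun i => hs i
      have h3 := Metric.infDist_le_infDist_add_dist (s := W) (x := V 1)
        (y := (WithLp.toLp 2 fun _ => B : Vec m))
      rw [dist_eq_norm] at h3
      have h4 := hdiff (V 1) (WithLp.toLp 2 fun _ => B) (hVB 1 (by simp [h1]))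
        (fun i => by simp [abs_of_nonneg hB])
      rw [h2, Nat.cast_one, div_one, Real.sqrt_sq hK0]
      linarith
    | succ t ht ih =>
      intro htT
      have ih := ih (by omega)
      have htm : t ∈ Finset.Icc 1 T := Finset.mem_Icc.2 ⟨ht, by omega⟩
      have htm' : t + 1 ∈ Finset.Icc 1 T := Finset.mem_Icc.2 ⟨by omega, htT⟩
      have ht1 : (1 : ℝ) ≤ t := by exact_mod_cast ht
      have hnorm : ‖V (t + 1) - runningAverage V t‖ ≤ K :=
        hdiff _ _ (hVB _ htm') fun i => abs_runningAverage_le ht fun j hj =>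
          hVB j (Finset.mem_Icc.2 ⟨(Finset.mem_Icc.1 hj).1, by
            have := (Finset.mem_Icc.1 hj).2; omega⟩) i
      push_cast
      -- Within distance `r`, averaging moves the point by at most `K / (t + 1) ≤ K / √(t + 1)`;
      -- beyond it, Blackwell's step applies.
      rcases le_or_gt (Metric.infDist (runningAverage V t) W) r with hle | hgt
      · have h1 := Metric.infDist_le_infDist_add_dist (s := W) (x := runningAverage V (t + 1))
          (y := runningAverage V t)
        rw [dist_eq_norm, runningAverage_succ V ht, add_sub_cancel_left, norm_smul,
          Real.norm_of_nonneg (by positivity), ← runningAverage_succ V ht] at h1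
        have h2 : ((t : ℝ) + 1)⁻¹ * ‖V (t + 1) - runningAverage V t‖ ≤ √(K ^ 2 / (t + 1)) := by
          refine Real.le_sqrt_of_sq_le ?_
          rw [mul_pow]
          calc ((t : ℝ) + 1)⁻¹ ^ 2 * ‖V (t + 1) - runningAverage V t‖ ^ 2
              ≤ ((t : ℝ) + 1)⁻¹ * K ^ 2 := by
                refine mul_le_mul ?_ (pow_le_pow_left₀ (norm_nonneg _) hnorm 2)
                  (by positivity) (by positivity)
                rw [pow_two]
                exact mul_le_of_le_one_left (by positivity)
                  (inv_le_one_of_one_le₀ (by linarith))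
            _ = K ^ 2 / (t + 1) := by rw [div_eq_inv_mul]
        linarith
      · have hv : runningAverage V t ∉ W := fun h => by
          rw [Metric.infDist_zero_of_mem h] at hgt
          linarith
        obtain ⟨w, hw, he⟩ := (hdir t htm (by omega)).2 hv
        have hne : w ≠ runningAverage V t := fun h => hv (h ▸ hw.1)
        refine sq_excess_step hw hr0 hgt
          (inner_projDir_le hW hw hne he (hΔ _ htm') (hV _ htm')) hnorm ht1 ?_
          (runningAverage_succ V ht)
        rw [← Real.sq_sqrt (show 0 ≤ K ^ 2 / t by positivity)]
        exact pow_le_pow_left₀ (by linarith) (by linarith) 2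
  have h := key T hT le_rfl
  rw [Real.sqrt_div (sq_nonneg K), Real.sqrt_sq hK0] at h
  calc _ ≤ _ := h
    _ = _ := by rw [hK]; ring

end

/-! ### Divergence of averaged policies. -/

/-- Countable generation provides jointly measurable densities. Measurability in the prompt is what
lets finite sums leave the integral defining `Model.kl`. -/
theorem measurable_klDiv_kernel {X : Type u} {Y : Type v} [MeasurableSpace X] [MeasurableSpace Y]
    [MeasurableSpace.CountablyGenerated Y] (κ η : Kernel X Y) [IsFiniteKernel κ]
    [IsFiniteKernel η] : Measurable fun x => klDiv (κ x) (η x) := by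
  classical
  have h : (fun x => klDiv (κ x) (η x)) = fun x => if κ x ≪ η x then
      ∫⁻ y, ENNReal.ofReal (klFun (κ.rnDeriv η x y).toReal) ∂(η x) else ∞ := by
    ext x
    rw [klDiv_eq_lintegral_klFun]
    split_ifs with hx
    · refine lintegral_congr_ae ?_
      filter_upwards [κ.rnDeriv_eq_rnDeriv_measure (η := η) (a := x)] with y hy
      rw [hy]
    · rfl
  rw [h]
  refine Measurable.ite (κ.measurableSet_absolutelyContinuous η) ?_ measurable_const
  refine Measurable.lintegral_kernel_prod_right (κ := η) ?_
  exact (measurable_klFun.comp (κ.measurable_rnDeriv η).ennreal_toReal).ennreal_ofReal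

/-- The divergence is convex in its first argument. -/
theorem klDiv_average_le {Y : Type v} [MeasurableSpace Y] {ι : Type*} (s : Finset ι)
    (hs : s.Nonempty) (μ : ι → Measure Y) (ν : Measure Y) [∀ i, IsFiniteMeasure (μ i)]
    [IsFiniteMeasure ν] :
    klDiv ((s.card : ℝ≥0∞)⁻¹ • ∑ i ∈ s, μ i) ν ≤ (s.card : ℝ≥0∞)⁻¹ * ∑ i ∈ s, klDiv (μ i) ν := by
  have hc0 : (s.card : ℝ≥0∞) ≠ 0 := by exact_mod_cast hs.card_pos.ne'
  have hcr : (0 : ℝ) < s.card := by exact_mod_cast hs.card_pos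
  have hct : (s.card : ℝ≥0∞)⁻¹ ≠ ∞ := ENNReal.inv_ne_top.2 hc0
  by_cases hac : ∀ i ∈ s, μ i ≪ ν
  swap
  · push Not at hac
    obtain ⟨i, hi, hi'⟩ := hac
    have : ∑ i ∈ s, klDiv (μ i) ν = ∞ := ENNReal.sum_eq_top.2 ⟨i, hi, klDiv_of_not_ac hi'⟩
    rw [this, ENNReal.mul_top (by simp)]
    exact le_top
  -- The averaged measure has the averaged density, and Jensen's inequality for `klFun` applies
  -- pointwise.
  set f : Y → ℝ≥0∞ := fun y => (s.card : ℝ≥0∞)⁻¹ * ∑ i ∈ s, (μ i).rnDeriv ν y with hf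
  have hfm : Measurable f :=
    (Finset.measurable_fun_sum s fun i _ => Measure.measurable_rnDeriv _ _).const_mul _
  have hμ : (s.card : ℝ≥0∞)⁻¹ • ∑ i ∈ s, μ i = ν.withDensity f := by
    ext t ht
    rw [withDensity_apply _ ht, hf, lintegral_const_mul' _ _ hct,
      lintegral_finsetSum _ fun i _ => Measure.measurable_rnDeriv _ _]
    simp only [Measure.smul_apply, Measure.finsetSum_apply, smul_eq_mul]
    congr 1
    refine Finset.sum_congr rfl fun i hi => ?_
    rw [Measure.setLIntegral_rnDeriv (hac i hi)]
  have hfin : IsFiniteMeasure ((s.card : ℝ≥0∞)⁻¹ • ∑ i ∈ s, μ i) :=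
    Measure.smul_finite _ hct
  have hac' : (s.card : ℝ≥0∞)⁻¹ • ∑ i ∈ s, μ i ≪ ν := hμ ▸ withDensity_absolutelyContinuous _ _
  rw [klDiv_eq_lintegral_klFun_of_ac hac']
  calc ∫⁻ y, ENNReal.ofReal (klFun (((s.card : ℝ≥0∞)⁻¹ • ∑ i ∈ s, μ i).rnDeriv ν y).toReal) ∂ν
      ≤ ∫⁻ y, (s.card : ℝ≥0∞)⁻¹ *
          ∑ i ∈ s, ENNReal.ofReal (klFun ((μ i).rnDeriv ν y).toReal) ∂ν := by
        have hlt : ∀ᵐ y ∂ν, ∀ i ∈ s, (μ i).rnDeriv ν y < ∞ :=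
          (Finset.eventually_all s).2 fun i _ => Measure.rnDeriv_lt_top _ _
        have hrn : ((s.card : ℝ≥0∞)⁻¹ • ∑ i ∈ s, μ i).rnDeriv ν =ᵐ[ν] f := by
          rw [hμ]; exact Measure.rnDeriv_withDensity ν hfm
        refine lintegral_mono_ae ?_
        filter_upwards [hlt, hrn] with y hy hy'
        rw [hy', hf]
        simp only
        rw [ENNReal.toReal_mul, ENNReal.toReal_sum fun i hi => (hy i hi).ne, ENNReal.toReal_inv,
          ENNReal.toReal_natCast, Finset.mul_sum]
        have h := convexOn_klFun.map_sum_le (t := s) (w := fun _ => (s.card : ℝ)⁻¹)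
          (p := fun i => ((μ i).rnDeriv ν y).toReal) (fun _ _ => by positivity)
          (by simp [hcr.ne']) (fun i _ => ENNReal.toReal_nonneg)
        simp only [smul_eq_mul] at h
        refine (ENNReal.ofReal_le_ofReal h).trans ?_
        rw [← Finset.mul_sum, ENNReal.ofReal_mul (by positivity),
          ENNReal.ofReal_sum_of_nonneg fun i _ => klFun_nonneg ENNReal.toReal_nonneg,
          ENNReal.ofReal_inv_of_pos hcr, ENNReal.ofReal_natCast]
    _ = (s.card : ℝ≥0∞)⁻¹ * ∑ i ∈ s, klDiv (μ i) ν := by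
        rw [lintegral_const_mul' _ _ hct, lintegral_finsetSum]
        · congr 1
          exact Finset.sum_congr rfl fun i hi => (klDiv_eq_lintegral_klFun_of_ac (hac i hi)).symm
        · exact fun i _ => (measurable_klFun.comp
            (Measure.measurable_rnDeriv _ _).ennreal_toReal).ennreal_ofReal

theorem isMarkovKernel_avgPolicy {X : Type u} {Y : Type v} [MeasurableSpace X]
    [MeasurableSpace Y] {T : ℕ} (hT : 1 ≤ T) {π : ℕ → Kernel X Y}
    (h : ∀ t ∈ Finset.Icc 1 T, IsMarkovKernel (π t)) : IsMarkovKernel (avgPolicy T π) := by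
  refine ⟨fun x => ⟨?_⟩⟩
  change ((T : ℝ≥0∞)⁻¹ • ∑ t ∈ Finset.Icc 1 T, π t x) Set.univ = 1
  simp only [Measure.smul_apply, Measure.finsetSum_apply, smul_eq_mul]
  rw [Finset.sum_congr rfl fun t ht => by
    have := h t ht
    exact measure_univ (μ := π t x)]
  simp only [Finset.sum_const, Nat.card_Icc, Nat.add_sub_cancel, nsmul_eq_mul, mul_one]
  exact ENNReal.inv_mul_cancel (by exact_mod_cast (by omega : T ≠ 0)) (ENNReal.natCast_ne_top T)

namespace Model

variable {X : Type u} {Y : Type v} [MeasurableSpace X] [MeasurableSpace Y] {m d : ℕ}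

theorem kl_piRef (Q : Model X Y m d) : Q.kl Q.piRef = 0 := by
  have := Q.markov_ref
  simp [kl, klDiv_self]

theorem isPolicy_piRef (Q : Model X Y m d) : Q.IsPolicy Q.piRef :=
  ⟨Q.markov_ref, by rw [Q.kl_piRef]; exact ENNReal.zero_ne_top⟩

theorem kl_avgPolicy_le [MeasurableSpace.CountablyGenerated Y] (Q : Model X Y m d) {T : ℕ}
    (hT : 1 ≤ T) {π : ℕ → Kernel X Y} (h : ∀ t ∈ Finset.Icc 1 T, IsMarkovKernel (π t)) :
    Q.kl (avgPolicy T π) ≤ (T : ℝ≥0∞)⁻¹ * ∑ t ∈ Finset.Icc 1 T, Q.kl (π t) := by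
  have := Q.markov_ref
  have hTi : (T : ℝ≥0∞)⁻¹ ≠ ∞ := ENNReal.inv_ne_top.2 (by exact_mod_cast (by omega : T ≠ 0))
  have hm : ∀ t ∈ Finset.Icc 1 T, Measurable fun x => klDiv (π t x) (Q.piRef x) := fun t ht => by
    have := h t ht
    exact measurable_klDiv_kernel _ _
  unfold kl
  rw [← lintegral_finsetSum _ hm, ← lintegral_const_mul' _ _ hTi]
  refine lintegral_mono fun x => ?_
  -- Sums are moved to a subtype because `klDiv_average_le` wants every measure of the family
  -- finite, which is known only for rounds up to `T`.
  have hs : ∀ f : ℕ → Measure Y, ∑ t ∈ Finset.Icc 1 T, f t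
      = ∑ t : Finset.Icc 1 T, f t := fun f => (Finset.sum_coe_sort _ _).symm
  have hs' : ∀ f : ℕ → ℝ≥0∞, ∑ t ∈ Finset.Icc 1 T, f t
      = ∑ t : Finset.Icc 1 T, f t := fun f => (Finset.sum_coe_sort _ _).symm
  have hfin : ∀ t : Finset.Icc 1 T, IsFiniteMeasure (π t x) := fun t => by
    have := h t t.2
    infer_instance
  have := klDiv_average_le (Finset.univ : Finset (Finset.Icc 1 T))
    ⟨⟨1, by simp [hT]⟩, Finset.mem_univ _⟩ (fun t => π t x) (Q.piRef x)
  simp only [Finset.card_univ, Fintype.card_coe, Nat.card_Icc, Nat.add_sub_cancel] at this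
  rw [hs']
  change klDiv ((T : ℝ≥0∞)⁻¹ • ∑ t ∈ Finset.Icc 1 T, π t x) _ ≤ _
  rw [hs]
  exact this

theorem isPolicy_avgPolicy [MeasurableSpace.CountablyGenerated Y] (Q : Model X Y m d) {T : ℕ}
    (hT : 1 ≤ T) {π : ℕ → Kernel X Y} (h : ∀ t ∈ Finset.Icc 1 T, Q.IsPolicy (π t)) :
    Q.IsPolicy (avgPolicy T π) := by
  refine ⟨isMarkovKernel_avgPolicy hT fun t ht => (h t ht).1,
    ne_top_of_le_ne_top ?_ (Q.kl_avgPolicy_le hT fun t ht => (h t ht).1)⟩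
  exact ENNReal.mul_ne_top (ENNReal.inv_ne_top.2 (by exact_mod_cast (by omega : T ≠ 0)))
    (ENNReal.sum_ne_top.2 fun t ht => (h t ht).2)

theorem toReal_kl_avgPolicy_le [MeasurableSpace.CountablyGenerated Y] (Q : Model X Y m d) {T : ℕ}
    (hT : 1 ≤ T) {π : ℕ → Kernel X Y} (h : ∀ t ∈ Finset.Icc 1 T, Q.IsPolicy (π t)) :
    (Q.kl (avgPolicy T π)).toReal ≤ (T : ℝ)⁻¹ * ∑ t ∈ Finset.Icc 1 T, (Q.kl (π t)).toReal := by
  have hne : (T : ℝ≥0∞)⁻¹ * ∑ t ∈ Finset.Icc 1 T, Q.kl (π t) ≠ ∞ :=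
    ENNReal.mul_ne_top (ENNReal.inv_ne_top.2 (by exact_mod_cast (by omega : T ≠ 0)))
      (ENNReal.sum_ne_top.2 fun t ht => (h t ht).2)
  have := ENNReal.toReal_mono hne (Q.kl_avgPolicy_le hT fun t ht => (h t ht).1)
  rwa [ENNReal.toReal_mul, ENNReal.toReal_sum fun t ht => (h t ht).2, ENNReal.toReal_inv,
    ENNReal.toReal_natCast] at this

end Model

/-! ### Values of policies and their dependence on the parameters. -/

namespace Model

variable {X : Type u} {Y : Type v} [MeasurableSpace X] [MeasurableSpace Y] {m d : ℕ}

theorem measurable_reward (Q : Model X Y m d) (i : Fin m) (θ : Vec d) :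
    Measurable (Function.uncurry (Q.reward i θ)) :=
  measurable_const.inner (Q.φ_measurable i)

theorem abs_reward_le (Q : Model X Y m d) (i : Fin m) (θ : Vec d) (x : X) (y : Y) :
    |Q.reward i θ x y| ≤ ‖θ‖ :=
  (abs_real_inner_le_norm _ _).trans
    (mul_le_of_le_one_right (norm_nonneg _) (Q.φ_norm i x y))

theorem integrable_inner {π : Kernel X Y} [IsMarkovKernel π] {f : X → Y → ℝ}
    (hf : Measurable (Function.uncurry f)) {c : ℝ} (hc : ∀ x y, |f x y| ≤ c) (x : X) :
    Integrable (f x) (π x) :=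
  Integrable.of_bound (hf.comp measurable_prodMk_left).aestronglyMeasurable c
    (Filter.Eventually.of_forall fun y => hc x y)

theorem integrable_outer (Q : Model X Y m d) {π : Kernel X Y} [IsMarkovKernel π] {f : X → Y → ℝ}
    (hf : Measurable (Function.uncurry f)) {c : ℝ} (hc : ∀ x y, |f x y| ≤ c) :
    Integrable (fun x => ∫ y, f x y ∂(π x)) Q.ρ := by
  have := Q.prob_ρ
  refine Integrable.of_bound (hf.stronglyMeasurable.integral_kernel_prod_right
    (κ := π)).aestronglyMeasurable c (Filter.Eventually.of_forall fun x => ?_)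
  simpa using norm_integral_le_of_norm_le_const (μ := π x) (f := f x)
    (Filter.Eventually.of_forall fun y => hc x y)

theorem expect_mono (Q : Model X Y m d) {π : Kernel X Y} [IsMarkovKernel π] {f g : X → Y → ℝ}
    (hf : Measurable (Function.uncurry f)) (hg : Measurable (Function.uncurry g)) {c c' : ℝ}
    (hc : ∀ x y, |f x y| ≤ c) (hc' : ∀ x y, |g x y| ≤ c') (h : ∀ x y, f x y ≤ g x y) :
    Q.expect π f ≤ Q.expect π g :=
  integral_mono (Q.integrable_outer hf hc) (Q.integrable_outer hg hc') fun x =>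
    integral_mono (integrable_inner hf hc x) (integrable_inner hg hc' x) (h x)

theorem expect_const (Q : Model X Y m d) {π : Kernel X Y} [IsMarkovKernel π] (a : ℝ) :
    Q.expect π (fun _ _ => a) = a := by
  have := Q.prob_ρ
  simp [expect]

theorem expect_reward_mem (Q : Model X Y m d) {π : Kernel X Y} [IsMarkovKernel π] {i : Fin m}
    {θ : Vec d} (hθ : θ ∈ Q.paramSet i) :
    0 ≤ Q.expect π (Q.reward i θ) ∧ Q.expect π (Q.reward i θ) ≤ Q.B := by
  have hr := Q.measurable_reward i θ
  have ha := Q.abs_reward_le i θ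
  constructor
  · rw [← Q.expect_const (π := π) 0]
    exact Q.expect_mono measurable_const hr (fun _ _ => le_rfl) ha fun x y => (hθ.2.1 x y).1
  · rw [← Q.expect_const (π := π) Q.B]
    exact Q.expect_mono hr measurable_const ha (fun _ _ => le_rfl) fun x y => (hθ.2.1 x y).2

theorem expect_reward_le (Q : Model X Y m d) {π : Kernel X Y} [IsMarkovKernel π] (i : Fin m)
    (θ θ' : Vec d) :
    Q.expect π (Q.reward i θ) ≤ Q.expect π (Q.reward i θ') + ‖θ - θ'‖ := by
  have h1 : Q.expect π (Q.reward i θ) ≤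
      Q.expect π (fun x y => Q.reward i θ' x y + ‖θ - θ'‖) := by
    refine Q.expect_mono (Q.measurable_reward i θ) ((Q.measurable_reward i θ').add_const _)
      (Q.abs_reward_le i θ) (c' := ‖θ'‖ + ‖θ - θ'‖) (fun x y => ?_) fun x y => ?_
    · exact (abs_add_le _ _).trans (add_le_add (Q.abs_reward_le i θ' x y)
        (abs_of_nonneg (norm_nonneg _)).le)
    · have h := (le_abs_self _).trans (Q.abs_reward_le i (θ - θ') x y)
      simp only [reward, inner_sub_left] at h ⊢
      linarith
  refine h1.trans_eq ?_
  have := Q.prob_ρ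
  have h2 : ∀ x, ∫ y, (Q.reward i θ' x y + ‖θ - θ'‖) ∂(π x)
      = ∫ y, Q.reward i θ' x y ∂(π x) + ‖θ - θ'‖ := fun x => by
    rw [integral_add (integrable_inner (Q.measurable_reward i θ') (Q.abs_reward_le i θ') x)
      (integrable_const _)]
    simp
  unfold expect
  simp only [h2]
  rw [integral_add (Q.integrable_outer (Q.measurable_reward i θ') (Q.abs_reward_le i θ'))
    (integrable_const _)]
  simp

theorem expect_avgPolicy (Q : Model X Y m d) {T : ℕ} {π : ℕ → Kernel X Y}
    (h : ∀ t ∈ Finset.Icc 1 T, IsMarkovKernel (π t)) (i : Fin m) (θ : Vec d) :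
    Q.expect (avgPolicy T π) (Q.reward i θ)
      = (T : ℝ)⁻¹ * ∑ t ∈ Finset.Icc 1 T, Q.expect (π t) (Q.reward i θ) := by
  have h1 : ∀ x, ∫ y, Q.reward i θ x y ∂(avgPolicy T π x)
      = (T : ℝ)⁻¹ * ∑ t ∈ Finset.Icc 1 T, ∫ y, Q.reward i θ x y ∂(π t x) := fun x => by
    change ∫ y, Q.reward i θ x y ∂((T : ℝ≥0∞)⁻¹ • ∑ t ∈ Finset.Icc 1 T, π t x) = _
    rw [integral_smul_measure, integral_finsetSum_measure]
    · simp
    · intro t ht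
      have := h t ht
      exact integrable_inner (Q.measurable_reward i θ) (Q.abs_reward_le i θ) x
  unfold expect
  simp only [h1]
  rw [integral_const_mul, integral_finsetSum]
  intro t ht
  have := h t ht
  exact Q.integrable_outer (Q.measurable_reward i θ) (Q.abs_reward_le i θ)

theorem J_eq_sum_valueVec (Q : Model X Y m d) (θ : Fin m → Vec d) (e : Vec m) (π : Kernel X Y) :
    Q.J θ e π = ∑ i, e i * Q.valueVec θ π i := rfl

theorem valueVec_le (Q : Model X Y m d) {π : Kernel X Y} [IsMarkovKernel π]
    (θ θ' : Fin m → Vec d) (i : Fin m) :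
    Q.valueVec θ π i ≤ Q.valueVec θ' π i + ‖θ i - θ' i‖ := by
  have := Q.expect_reward_le (π := π) i (θ i) (θ' i)
  simp only [valueVec]
  linarith

theorem J_le (Q : Model X Y m d) {π : Kernel X Y} [IsMarkovKernel π]
    {e : Vec m} (he : e ∈ simplex m) (θ θ' : Fin m → Vec d) :
    Q.J θ e π ≤ Q.J θ' e π + ∑ i, e i * ‖θ i - θ' i‖ := by
  rw [J_eq_sum_valueVec, J_eq_sum_valueVec, ← Finset.sum_add_distrib]
  refine Finset.sum_le_sum fun i _ => ?_
  rw [← mul_add]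
  exact mul_le_mul_of_nonneg_left (Q.valueVec_le θ θ' i) (he.1 i)

theorem valueVec_le_bound (Q : Model X Y m d) {π : Kernel X Y} [IsMarkovKernel π]
    {θ : Fin m → Vec d} (hθ : ∀ i, θ i ∈ Q.paramSet i) (i : Fin m) :
    Q.valueVec θ π i ≤ Q.B := by
  have h1 := (Q.expect_reward_mem (π := π) (hθ i)).2
  have h2 : 0 ≤ Q.β * (Q.kl π).toReal := mul_nonneg Q.β_pos.le ENNReal.toReal_nonneg
  simp only [valueVec]
  linarith

theorem sum_simplex_le {e : Vec m} (he : e ∈ simplex m) {f : Fin m → ℝ} {b : ℝ}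
    (h : ∀ i, f i ≤ b) : ∑ i, e i * f i ≤ b := by
  calc ∑ i, e i * f i ≤ ∑ i, e i * b :=
        Finset.sum_le_sum fun i _ => mul_le_mul_of_nonneg_left (h i) (he.1 i)
    _ = b := by rw [← Finset.sum_mul, he.2, one_mul]

theorem bddAbove_J (Q : Model X Y m d) {e : Vec m} (he : e ∈ simplex m) {θ : Fin m → Vec d}
    (hθ : ∀ i, θ i ∈ Q.paramSet i) :
    BddAbove {a | ∃ π, Q.IsPolicy π ∧ a = Q.J θ e π} := by
  refine ⟨Q.B, ?_⟩
  rintro _ ⟨π, hπ, rfl⟩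
  have := hπ.1
  exact sum_simplex_le he fun i => Q.valueVec_le_bound hθ i

/-- A supremum of uniformly Lipschitz functions of the parameters inherits the Lipschitz bound;
`hθ'` keeps the supremum on the right finite. -/
theorem maxJ_le (Q : Model X Y m d) {e : Vec m} (he : e ∈ simplex m) (θ : Fin m → Vec d)
    {θ' : Fin m → Vec d} (hθ' : ∀ i, θ' i ∈ Q.paramSet i) :
    Q.maxJ θ e ≤ Q.maxJ θ' e + ∑ i, e i * ‖θ i - θ' i‖ := by
  refine csSup_le ⟨_, Q.piRef, Q.isPolicy_piRef, rfl⟩ ?_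
  rintro _ ⟨π, hπ, rfl⟩
  have := hπ.1
  exact (Q.J_le he θ θ').trans (add_le_add (le_csSup (Q.bddAbove_J he hθ') ⟨π, hπ, rfl⟩) le_rfl)

/-- The reference policy has divergence zero and nonnegative value, so a greedy policy pays at most
`B` for its divergence. -/
theorem IsGreedy.abs_valueVec_le {Q : Model X Y m d} {e : Vec m} (he : e ∈ simplex m)
    {θ : Fin m → Vec d} (hθ : ∀ i, θ i ∈ Q.paramSet i) {π : Kernel X Y}
    (h : Q.IsGreedy θ e π) (i : Fin m) : |Q.valueVec θ π i| ≤ Q.B := by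
  have := h.1.1
  refine abs_le.2 ⟨?_, Q.valueVec_le_bound hθ i⟩
  have h1 := h.2 _ Q.isPolicy_piRef
  have hm := Q.markov_ref
  have h2 : 0 ≤ Q.J θ e Q.piRef := by
    refine Finset.sum_nonneg fun i _ => mul_nonneg (he.1 i) ?_
    rw [Q.kl_piRef]
    simpa using (Q.expect_reward_mem (π := Q.piRef) (hθ i)).1
  have h3 : Q.J θ e π ≤ Q.B - Q.β * (Q.kl π).toReal :=
    sum_simplex_le he fun i => sub_le_sub_right (Q.expect_reward_mem (π := π) (hθ i)).2 _
  have h4 := (Q.expect_reward_mem (π := π) (hθ i)).1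
  simp only [valueVec]
  linarith

/-- The expected reward vector of the averaged policy dominates the averaged reward vectors. -/
theorem runningAverage_S_le [MeasurableSpace.CountablyGenerated Y] (Q : Model X Y m d) {T : ℕ}
    (hT : 1 ≤ T) {π : ℕ → Kernel X Y} (h : ∀ t ∈ Finset.Icc 1 T, Q.IsPolicy (π t)) (i : Fin m) :
    runningAverage (fun t => Q.S (π t)) T i ≤ Q.S (avgPolicy T π) i := by
  have h1 := mul_le_mul_of_nonneg_left (Q.toReal_kl_avgPolicy_le hT h) Q.β_pos.le
  simp only [S, valueVec, runningAverage, PiLp.smul_apply, WithLp.ofLp_sum, Finset.sum_apply,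
    smul_eq_mul]
  rw [Q.expect_avgPolicy fun t ht => (h t ht).1, Finset.sum_sub_distrib, ← Finset.mul_sum,
    mul_sub]
  linarith

end Model

/-! ### The logistic loss -/

/-- The product is `σ(z) σ(-z)`: one factor is at least `1 / 2`, the other at least `σ(-b) ≥ exp
(-b) / 2`. -/
theorem exp_neg_div_four_le_sigmoid_mul {b z : ℝ} (hz : |z| ≤ b) :
    Real.exp (-b) / 4 ≤ Real.sigmoid z * (1 - Real.sigmoid z) := by
  have hb : 0 ≤ b := (abs_nonneg z).trans hz
  have h1 : ∀ y, |y| ≤ b → Real.exp (-b) / 2 ≤ Real.sigmoid y := fun y hy => by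
    refine le_trans ?_ (Real.sigmoid_le (neg_le_of_abs_le hy))
    rw [Real.sigmoid_def, neg_neg, Real.exp_neg, ← one_div, ← one_div, div_div]
    refine one_div_le_one_div_of_le (by positivity) ?_
    have := Real.one_le_exp hb
    linarith
  have h2 : ∀ y, 0 ≤ y → (1 / 2 : ℝ) ≤ Real.sigmoid y := fun y hy => by
    have := Real.sigmoid_le hy
    rw [Real.sigmoid_zero] at this
    linarith
  rw [← Real.sigmoid_neg]
  have hz' : |(-z)| ≤ b := by rwa [abs_neg]
  have he := Real.exp_pos (-b)
  rcases le_total 0 z with h | h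
  · nlinarith [h1 _ hz', h2 z h]
  · nlinarith [h1 _ hz, h2 (-z) (by linarith)]

theorem hasDerivAt_log_sigmoid (z : ℝ) :
    HasDerivAt (fun z => Real.log (Real.sigmoid z)) (1 - Real.sigmoid z) z := by
  have h := (Real.hasDerivAt_sigmoid z).log (Real.sigmoid_pos z).ne'
  rwa [mul_div_cancel_left₀ _ (Real.sigmoid_pos z).ne'] at h

/-- The logistic loss is strongly convex on bounded intervals. -/
theorem neg_log_sigmoid_ge {b z z₀ : ℝ} (hz : |z| ≤ b) (hz₀ : |z₀| ≤ b) :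
    -Real.log (Real.sigmoid z₀) - (1 - Real.sigmoid z₀) * (z - z₀)
      + Real.exp (-b) / 8 * (z - z₀) ^ 2 ≤ -Real.log (Real.sigmoid z) := by
  set κ := Real.exp (-b) / 4 with hκ
  have hmem : ∀ y : ℝ, |y| ≤ b ↔ y ∈ Set.Icc (-b) b := fun y => abs_le
  have hp : MonotoneOn (fun y => Real.sigmoid y - κ * y) (Set.Icc (-b) b) := by
    have hd : ∀ y, HasDerivAt (fun y => Real.sigmoid y - κ * y)
        (Real.sigmoid y * (1 - Real.sigmoid y) - κ) y := fun y => by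
      exact ((Real.hasDerivAt_sigmoid y).sub ((hasDerivAt_id y).const_mul κ)).congr_deriv
        (by rw [mul_one])
    refine monotoneOn_of_deriv_nonneg (convex_Icc _ _)
      (fun y _ => (hd y).continuousAt.continuousWithinAt)
      (fun y _ => (hd y).differentiableAt.differentiableWithinAt) fun y hy => ?_
    rw [interior_Icc] at hy
    rw [(hd y).deriv, sub_nonneg]
    exact exp_neg_div_four_le_sigmoid_mul ((hmem y).2 (Set.Ioo_subset_Icc_self hy))
  -- The derivative of `h` is the monotone function of `hp` minus its value at `z₀`, so `h` is
  -- minimal at `z₀`.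
  set h : ℝ → ℝ := fun y => -Real.log (Real.sigmoid y) + (1 - Real.sigmoid z₀) * (y - z₀)
    - κ / 2 * (y - z₀) ^ 2 with hh
  have hd : ∀ y, HasDerivAt h ((Real.sigmoid y - κ * y) - (Real.sigmoid z₀ - κ * z₀)) y :=
    fun y => by
      have h1 := (hasDerivAt_log_sigmoid y).neg
      have h2 := ((hasDerivAt_id y).sub_const z₀).const_mul (1 - Real.sigmoid z₀)
      have h3 := (((hasDerivAt_id y).sub_const z₀).pow 2).const_mul (κ / 2)
      exact ((h1.add h2).sub h3).congr_deriv (by simp; ring)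
  have h0 : h z₀ = -Real.log (Real.sigmoid z₀) := by simp [hh]
  have key : h z₀ ≤ h z := by
    rw [hmem] at hz hz₀
    rcases le_total z₀ z with hle | hle
    · have hsub : Set.Icc z₀ z ⊆ Set.Icc (-b) b := Set.Icc_subset_Icc hz₀.1 hz.2
      have hm : MonotoneOn h (Set.Icc z₀ z) := by
        refine monotoneOn_of_deriv_nonneg (convex_Icc _ _)
          (fun y _ => (hd y).continuousAt.continuousWithinAt)
          (fun y _ => (hd y).differentiableAt.differentiableWithinAt) fun y hy => ?_
        have hy' := interior_subset hy
        rw [(hd y).deriv, sub_nonneg]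
        exact hp hz₀ (hsub hy') hy'.1
      exact hm (Set.left_mem_Icc.2 hle) (Set.right_mem_Icc.2 hle) hle
    · have hsub : Set.Icc z z₀ ⊆ Set.Icc (-b) b := Set.Icc_subset_Icc hz.1 hz₀.2
      have hm : AntitoneOn h (Set.Icc z z₀) := by
        refine antitoneOn_of_deriv_nonpos (convex_Icc _ _)
          (fun y _ => (hd y).continuousAt.continuousWithinAt)
          (fun y _ => (hd y).differentiableAt.differentiableWithinAt) fun y hy => ?_
        have hy' := interior_subset hy
        rw [(hd y).deriv, sub_nonpos]
        exact hp (hsub hy') hz₀ hy'.2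
      exact hm (Set.left_mem_Icc.2 hle) (Set.right_mem_Icc.2 hle) hle
  rw [h0, hh] at key
  simp only at key
  have : κ / 2 = Real.exp (-b) / 8 := by rw [hκ]; ring
  rw [this] at key
  linarith

/-! ### The smallest eigenvalue -/

/-- Subtracting `lambdaMin A` times the identity shifts the spectrum into the nonnegative reals,
which makes the difference positive semidefinite. -/
theorem lambdaMin_mul_le {d : ℕ} {A : Matrix (Fin d) (Fin d) ℝ} (hA : A.IsHermitian)
    (x : Fin d → ℝ) : lambdaMin A * (x ⬝ᵥ x) ≤ x ⬝ᵥ A.mulVec x := by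
  have hbdd : BddBelow (spectrum ℝ A) := by
    rw [hA.spectrum_real_eq_range_eigenvalues]
    exact (Set.finite_range _).bddBelow
  have hH : (A - algebraMap ℝ _ (lambdaMin A)).IsHermitian := by
    refine hA.sub ?_
    rw [Algebra.algebraMap_eq_smul_one, Matrix.IsHermitian, Matrix.conjTranspose_smul,
      Matrix.conjTranspose_one, star_trivial]
  have hP : (A - algebraMap ℝ _ (lambdaMin A)).PosSemidef := by
    rw [Matrix.posSemidef_iff_isHermitian_and_spectrum_nonneg]
    refine ⟨hH, ?_⟩
    rw [← spectrum.sub_singleton_eq]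
    rintro _ ⟨a, ha, b, rfl, rfl⟩
    exact sub_nonneg.2 (csInf_le hbdd ha)
  have := hP.dotProduct_mulVec_nonneg x
  rw [Matrix.sub_mulVec, dotProduct_sub, Algebra.algebraMap_eq_smul_one, Matrix.smul_mulVec,
    Matrix.one_mulVec, dotProduct_smul, star_trivial, smul_eq_mul] at this
  linarith

theorem lambdaMin_nonneg {d : ℕ} {A : Matrix (Fin d) (Fin d) ℝ} (hA : A.PosSemidef) :
    0 ≤ lambdaMin A :=
  Real.sInf_nonneg fun _ ha =>
    (Matrix.posSemidef_iff_isHermitian_and_spectrum_nonneg.1 hA).2 ha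

/-! ### Likelihood and accuracy of the pessimistic estimates. -/

namespace Model

variable {X : Type u} {Y : Type v} [MeasurableSpace X] [MeasurableSpace Y] {m d M : ℕ}

/-- The difference of the features of the winner and the loser of a comparison. -/
def featureDiff (Q : Model X Y m d) (i : Fin m) (z : X × Y × Y) : Vec d :=
  Q.φ i z.1 z.2.1 - Q.φ i z.1 z.2.2

theorem reward_sub_reward (Q : Model X Y m d) (i : Fin m) (θ : Vec d) (z : X × Y × Y) :
    Q.reward i θ z.1 z.2.1 - Q.reward i θ z.1 z.2.2 = inner ℝ θ (Q.featureDiff i z) := by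
  simp only [reward, featureDiff, inner_sub_right]

theorem empCov_eq (Q : Model X Y m d) (i : Fin m) (data : Fin M → X × Y × Y) :
    Q.empCov i data = (M : ℝ)⁻¹ • ∑ j, Matrix.vecMulVec
      (Q.featureDiff i (data j)).ofLp (Q.featureDiff i (data j)).ofLp := rfl

theorem posSemidef_empCov (Q : Model X Y m d) (i : Fin m) (data : Fin M → X × Y × Y) :
    (Q.empCov i data).PosSemidef := by
  rw [empCov_eq]
  refine Matrix.PosSemidef.smul (Matrix.posSemidef_sum _ fun j _ => ?_) (by positivity)
  simpa using Matrix.posSemidef_vecMulVec_self_star (Q.featureDiff i (data j)).ofLp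

theorem lambdaMin_empCov_mul_le (Q : Model X Y m d) (hM : 1 ≤ M) (i : Fin m)
    (data : Fin M → X × Y × Y) (x : Vec d) :
    M * lambdaMin (Q.empCov i data) * ‖x‖ ^ 2 ≤ ∑ j, inner ℝ x (Q.featureDiff i (data j)) ^ 2 := by
  have hM0 : (M : ℝ) ≠ 0 := by positivity
  have h := lambdaMin_mul_le (Q.posSemidef_empCov i data).1 x.ofLp
  have h1 : x.ofLp ⬝ᵥ x.ofLp = ‖x‖ ^ 2 := by
    rw [EuclideanSpace.real_norm_sq_eq]
    simp [dotProduct, pow_two]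
  have h2 : x.ofLp ⬝ᵥ (Q.empCov i data).mulVec x.ofLp
      = (M : ℝ)⁻¹ * ∑ j, inner ℝ x (Q.featureDiff i (data j)) ^ 2 := by
    rw [empCov_eq, Matrix.smul_mulVec, dotProduct_smul, smul_eq_mul, Matrix.sum_mulVec,
      dotProduct_sum]
    congr 1
    refine Finset.sum_congr rfl fun j _ => ?_
    rw [Matrix.vecMulVec_mulVec, dotProduct_smul]
    simp only [PiLp.inner_apply, dotProduct, RCLike.inner_apply, conj_trivial,
      MulOpposite.smul_eq_mul_unop, MulOpposite.unop_op]
    rw [pow_two]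
    simp only [mul_comm]
  rw [h1, h2] at h
  calc (M : ℝ) * lambdaMin (Q.empCov i data) * ‖x‖ ^ 2
      = M * (lambdaMin (Q.empCov i data) * ‖x‖ ^ 2) := by ring
    _ ≤ M * ((M : ℝ)⁻¹ * ∑ j, inner ℝ x (Q.featureDiff i (data j)) ^ 2) :=
      mul_le_mul_of_nonneg_left h (by positivity)
    _ = _ := by rw [← mul_assoc, mul_inv_cancel₀ hM0, one_mul]

/-- The score of the log-likelihood, that is minus the gradient of `loss`. -/
def score (Q : Model X Y m d) (i : Fin m) (data : Fin M → X × Y × Y) (θ : Vec d) : Vec d :=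
  ∑ j, (1 - Real.sigmoid (inner ℝ θ (Q.featureDiff i (data j)))) • Q.featureDiff i (data j)

/-- Both rewards lie in `[0, b]`, which gives `b` instead of `2 * b`. -/
theorem abs_reward_sub_reward_le (Q : Model X Y m d) {i : Fin m} {θ : Vec d}
    (hθ : θ ∈ Q.paramSet i) {b : ℝ} (hb : ‖θ‖ ≤ b) (z : X × Y × Y) :
    |Q.reward i θ z.1 z.2.1 - Q.reward i θ z.1 z.2.2| ≤ b := by
  have h1 := (hθ.2.1 z.1 z.2.1).1
  have h2 := (hθ.2.1 z.1 z.2.2).1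
  have h3 := (le_abs_self _).trans ((Q.abs_reward_le i θ z.1 z.2.1).trans hb)
  have h4 := (le_abs_self _).trans ((Q.abs_reward_le i θ z.1 z.2.2).trans hb)
  exact abs_le.2 ⟨by linarith, by linarith⟩

/-- Quadratic growth of the negative log-likelihood. -/
theorem loss_sub_loss_ge (Q : Model X Y m d) (hM : 1 ≤ M) {i : Fin m} (data : Fin M → X × Y × Y)
    {θ θ₀ : Vec d} (hθ : θ ∈ Q.paramSet i) (hθ₀ : θ₀ ∈ Q.paramSet i) {b : ℝ} (hb : ‖θ‖ ≤ b)
    (hb₀ : ‖θ₀‖ ≤ b) :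
    Real.exp (-b) / 8 * (M * lambdaMin (Q.empCov i data) * ‖θ - θ₀‖ ^ 2)
      - ‖Q.score i data θ₀‖ * ‖θ - θ₀‖ ≤ Q.loss i data θ - Q.loss i data θ₀ := by
  have h1 : ∀ j, Real.exp (-b) / 8 * inner ℝ (θ - θ₀) (Q.featureDiff i (data j)) ^ 2
      - inner ℝ ((1 - Real.sigmoid (inner ℝ θ₀ (Q.featureDiff i (data j))))
          • Q.featureDiff i (data j)) (θ - θ₀)
      ≤ -Real.log (Real.sigmoid (inner ℝ θ (Q.featureDiff i (data j))))
        - -Real.log (Real.sigmoid (inner ℝ θ₀ (Q.featureDiff i (data j)))) := fun j => by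
    have ha := Q.abs_reward_sub_reward_le hθ hb (data j)
    have hb := Q.abs_reward_sub_reward_le hθ₀ hb₀ (data j)
    rw [reward_sub_reward] at ha hb
    have := neg_log_sigmoid_ge ha hb
    rw [inner_smul_left, real_inner_comm (θ - θ₀) (Q.featureDiff i (data j)), inner_sub_left]
    simp only [conj_trivial]
    linarith
  have h2 := Finset.sum_le_sum fun j (_ : j ∈ Finset.univ) => h1 j
  rw [Finset.sum_sub_distrib, Finset.sum_sub_distrib, ← Finset.mul_sum, ← sum_inner] at h2
  have h3 := real_inner_le_norm (Q.score i data θ₀) (θ - θ₀)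
  have h4 := mul_le_mul_of_nonneg_left (Q.lambdaMin_empCov_mul_le hM i data (θ - θ₀))
    (show 0 ≤ Real.exp (-b) / 8 by positivity)
  have h5 : ∀ θ : Vec d, Q.loss i data θ
      = ∑ j, -Real.log (Real.sigmoid (inner ℝ θ (Q.featureDiff i (data j)))) := fun θ => by
    simp only [loss, reward_sub_reward, Finset.sum_neg_distrib]
  rw [h5, h5]
  unfold score at h3 ⊢
  linarith

/-- A pessimistic estimate is close to the true parameter when the data cover all directions. -/
theorem IsOfflineEstimate.sqrt_sum_le {Q : Model X Y m d} (hM : 1 ≤ M)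
    (hstar : ∀ i, Q.θstar i ∈ Q.paramSet i) {b : ℝ}
    (hb : ∀ i, ∀ θ ∈ Q.paramSet i, ‖θ‖ ≤ b) {data : Fin m → Fin M → X × Y × Y} {e : Vec m}
    (he : e ∈ simplex m) {θ : Fin m → Vec d}
    (h : Q.IsOfflineEstimate (1 / √(M : ℝ)) data e θ) {G : ℝ} (hG : 0 ≤ G)
    (hscore : ∀ i, ‖Q.score i (data i) (Q.θstar i)‖ ≤ G * √(M : ℝ)) {l : ℝ} (hl : 0 ≤ l)
    (hlam : ∀ i, l ≤ lambdaMin (Q.empCov i (data i))) :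
    √(M : ℝ) * √(∑ i, ‖θ i - Q.θstar i‖ ^ 2) ≤ √(m : ℝ) * (8 * (G + 1) * Real.exp b
      * (l + 1 / (M : ℝ))⁻¹ + 2 * Real.exp b * (1 + (l + 1 / (M : ℝ))⁻¹)) := by
  have hMr : (0 : ℝ) < M := by positivity
  set s := √(M : ℝ) with hs
  have hs0 : 0 < s := Real.sqrt_pos.2 hMr
  have hss : s * s = M := Real.mul_self_sqrt hMr.le
  set n : Fin m → ℝ := fun i => ‖θ i - Q.θstar i‖ with hn
  have hn0 : ∀ i, 0 ≤ n i := fun i => norm_nonneg _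
  have hm : 0 < m := by
    rcases Nat.eq_zero_or_pos m with rfl | hm
    · exact absurd he.2 (by simp)
    · exact hm
  have hb0 : 0 ≤ b := (norm_nonneg _).trans (hb ⟨0, hm⟩ _ (hstar _))
  have hn2 : ∀ i, n i ≤ 2 * b := fun i => by
    have := norm_sub_le (θ i) (Q.θstar i)
    linarith [hb i _ (h.1 i), hb i _ (hstar i)]
  set Λ := l + 1 / (M : ℝ) with hΛ
  have hΛ0 : 0 < Λ := by positivity
  set κ := Real.exp (-b) / 4 with hκ
  have hκ0 : 0 < κ := by positivity
  set U := s * √(∑ i, n i ^ 2) with hU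
  have hU0 : 0 ≤ U := by positivity
  have hUsq : U ^ 2 = M * ∑ i, n i ^ 2 := by
    rw [hU, mul_pow, Real.sq_sqrt (Finset.sum_nonneg fun i _ => sq_nonneg _), pow_two, hss]
  have hsumn : s * ∑ i, n i ≤ √(m : ℝ) * U := by
    have h1 : ∑ i, n i ≤ √(m : ℝ) * √(∑ i, n i ^ 2) := by
      rw [← Real.sqrt_mul (by positivity)]
      refine Real.le_sqrt_of_sq_le ?_
      simpa using sq_sum_le_card_mul_sum_sq (s := Finset.univ) (f := n)
    calc s * ∑ i, n i ≤ s * (√(m : ℝ) * √(∑ i, n i ^ 2)) := mul_le_mul_of_nonneg_left h1 hs0.le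
      _ = _ := by rw [hU]; ring
  -- The true parameters are a competitor of the estimate, and `maxJ` changes by at most the
  -- parameter errors.
  have hopt : ∑ i, 1 / s * (Q.loss i (data i) (θ i) - Q.loss i (data i) (Q.θstar i))
      ≤ ∑ i, n i := by
    have h1 := h.2 _ hstar
    have h2 := Q.maxJ_le he Q.θstar h.1
    have h3 : ∑ i, e i * ‖Q.θstar i - θ i‖ ≤ ∑ i, n i := Finset.sum_le_sum fun i _ => by
      rw [norm_sub_rev]
      refine mul_le_of_le_one_left (norm_nonneg _) ?_
      rw [← he.2]
      exact Finset.single_le_sum (fun j _ => he.1 j) (Finset.mem_univ i)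
    simp only [offlineObjective] at h1
    simp only [mul_sub, Finset.sum_sub_distrib]
    linarith
  have hlow : ∑ i, (κ / 2 * (M * l * n i ^ 2) - G * s * n i) ≤ s * ∑ i, n i := by
    have h1 := mul_le_mul_of_nonneg_left hopt hs0.le
    rw [← Finset.mul_sum, ← mul_assoc, mul_one_div_cancel hs0.ne', one_mul] at h1
    refine le_trans (Finset.sum_le_sum fun i _ => ?_) h1
    refine le_trans ?_ (Q.loss_sub_loss_ge hM (data i) (h.1 i) (hstar i) (hb i _ (h.1 i))
      (hb i _ (hstar i)))
    have h2 : κ / 2 = Real.exp (-b) / 8 := by rw [hκ]; ring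
    rw [h2]
    have h3 : (M : ℝ) * l * n i ^ 2 ≤ M * lambdaMin (Q.empCov i (data i)) * n i ^ 2 :=
      mul_le_mul_of_nonneg_right (mul_le_mul_of_nonneg_left (hlam i) hMr.le) (sq_nonneg _)
    have h4 := mul_le_mul_of_nonneg_left h3 (show 0 ≤ Real.exp (-b) / 8 by positivity)
    have h5 := mul_le_mul_of_nonneg_right (hscore i) (hn0 i)
    linarith
  -- Adding `κ / 2 * ∑ i, n i ^ 2` turns `l` into `l + 1 / M`; the price is bounded through `n i ≤ 2
  -- * b`. In `G + 1`, `G` comes from the score and `1` from `maxJ`.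
  have hquad : κ / 2 * Λ * U ^ 2 ≤ (G + 1) * (√(m : ℝ) * U) + 2 * κ * m * b ^ 2 := by
    have h1 : ∑ i, n i ^ 2 ≤ m * (4 * b ^ 2) := by
      calc ∑ i, n i ^ 2 ≤ ∑ _i : Fin m, (2 * b) ^ 2 :=
            Finset.sum_le_sum fun i _ => pow_le_pow_left₀ (hn0 i) (hn2 i) 2
        _ = m * (4 * b ^ 2) := by
          rw [Finset.sum_const, Finset.card_univ, Fintype.card_fin, nsmul_eq_mul]; ring
    have h2 : Λ * U ^ 2 = M * l * ∑ i, n i ^ 2 + ∑ i, n i ^ 2 := by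
      rw [hUsq, hΛ]; field_simp
    rw [Finset.sum_sub_distrib, ← Finset.mul_sum, ← Finset.mul_sum, ← Finset.mul_sum] at hlow
    have h3 := mul_le_mul_of_nonneg_left hsumn (show 0 ≤ G + 1 by linarith)
    have h4 := mul_le_mul_of_nonneg_left h1 (show 0 ≤ κ / 2 by positivity)
    have h5 : κ / 2 * Λ * U ^ 2 = κ / 2 * (M * l * ∑ i, n i ^ 2) + κ / 2 * ∑ i, n i ^ 2 := by
      rw [mul_assoc, h2]; ring
    linarith
  set y := Λ⁻¹ with hy
  have hy0 : 0 < y := inv_pos.2 hΛ0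
  set x := Real.exp b with hx
  have hx1 : 1 ≤ x := Real.one_le_exp hb0
  have hbx : b ≤ x := by have := Real.add_one_le_exp b; linarith
  have hκx : κ⁻¹ = 4 * x := by rw [hκ, Real.exp_neg, ← hx]; field_simp
  have hsm : √(m : ℝ) ^ 2 = m := Real.sq_sqrt (by positivity)
  have hq2 : U ^ 2 ≤ 2 * (4 * (G + 1) * √(m : ℝ) * x * y) * U + 4 * m * b ^ 2 * y := by
    have h1 := mul_le_mul_of_nonneg_left hquad (show 0 ≤ 2 * κ⁻¹ * y by positivity)
    have h2 : 2 * κ⁻¹ * y * (κ / 2 * Λ * U ^ 2) = U ^ 2 := by rw [hy]; field_simp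
    have h3 : 2 * κ⁻¹ * y * ((G + 1) * (√(m : ℝ) * U) + 2 * κ * m * b ^ 2)
        = 2 * κ⁻¹ * y * ((G + 1) * (√(m : ℝ) * U)) + 4 * m * b ^ 2 * y := by
      field_simp; ring
    rw [h2, h3, hκx] at h1
    linarith
  -- Enlarging `√y` to `1 + y` and `b` to `exp b` keeps the final bound polynomial in `x` and `y`.
  have hβ : 4 * m * b ^ 2 * y ≤ (2 * √(m : ℝ) * x * (1 + y)) ^ 2 := by
    have h1 : b ^ 2 ≤ x ^ 2 := pow_le_pow_left₀ hb0 hbx 2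
    have h2 : y ≤ (1 + y) ^ 2 := by nlinarith
    calc 4 * m * b ^ 2 * y = 4 * m * (b ^ 2 * y) := by ring
      _ ≤ 4 * m * (x ^ 2 * (1 + y) ^ 2) :=
        mul_le_mul_of_nonneg_left (mul_le_mul h1 h2 hy0.le (by positivity)) (by positivity)
      _ = _ := by rw [mul_pow, mul_pow, mul_pow, hsm]; ring
  have hα0 : 0 ≤ 4 * (G + 1) * √(m : ℝ) * x * y := by positivity
  have hγ0 : 0 ≤ 2 * √(m : ℝ) * x * (1 + y) := by positivity
  -- For nonnegative `α`, `γ`, the inequality `U ^ 2 ≤ 2 α U + γ ^ 2` forces `U ≤ 2 α + γ`.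
  have hfin : U ≤ 2 * (4 * (G + 1) * √(m : ℝ) * x * y) + 2 * √(m : ℝ) * x * (1 + y) := by
    by_contra! hcon
    nlinarith
  calc U ≤ _ := hfin
    _ = _ := by ring

end Model

/-! ### Concentration of the labels and of the scores. -/

/-- The moment generating function of a centered Bernoulli variable is subgaussian. -/
theorem bernoulli_mgf_le {p : ℝ} (hp0 : 0 ≤ p) (hp1 : p ≤ 1) (a : ℝ) :
    p * Real.exp ((1 - p) * a) + (1 - p) * Real.exp (-p * a) ≤ Real.exp (a ^ 2 / 2) := by
  -- Symmetrization: by centering, the moment generating function at `-a` is at least `1`.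
  -- Multiplying by it gives that of the difference of two independent copies, which is at most
  -- `cosh a`.
  have hneg : 1 ≤ p * Real.exp (-((1 - p) * a)) + (1 - p) * Real.exp (p * a) := by
    have h1 := mul_le_mul_of_nonneg_left (Real.add_one_le_exp (-((1 - p) * a))) hp0
    have h2 := mul_le_mul_of_nonneg_left (Real.add_one_le_exp (p * a)) (sub_nonneg.2 hp1)
    nlinarith
  have hq : 0 ≤ 1 - p := sub_nonneg.2 hp1
  have hL : 0 ≤ p * Real.exp ((1 - p) * a) + (1 - p) * Real.exp (-p * a) := by positivity
  have e1 : Real.exp ((1 - p) * a) * Real.exp (-((1 - p) * a)) = 1 := by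
    rw [← Real.exp_add]; simp
  have e2 : Real.exp (-p * a) * Real.exp (p * a) = 1 := by
    rw [← Real.exp_add]; simp
  have e3 : Real.exp ((1 - p) * a) * Real.exp (p * a) = Real.exp a := by
    rw [← Real.exp_add]; ring_nf
  have e4 : Real.exp (-p * a) * Real.exp (-((1 - p) * a)) = Real.exp (-a) := by
    rw [← Real.exp_add]; ring_nf
  calc _ ≤ (p * Real.exp ((1 - p) * a) + (1 - p) * Real.exp (-p * a))
        * (p * Real.exp (-((1 - p) * a)) + (1 - p) * Real.exp (p * a)) :=
        le_mul_of_one_le_right hL hneg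
    _ = p ^ 2 + (1 - p) ^ 2 + 2 * p * (1 - p) * Real.cosh a := by
        rw [Real.cosh_eq, ← e3, ← e4]
        linear_combination p ^ 2 * e1 + (1 - p) ^ 2 * e2
    _ ≤ Real.cosh a := by
        nlinarith [Real.one_le_cosh a, mul_nonneg hp0 hq, sq_nonneg (1 - 2 * p)]
    _ ≤ _ := Real.cosh_le_exp_half_sq a

theorem btProb_nonneg {X : Type u} {Y : Type v} (r : X → Y → ℝ) (z : X × Y × Y) (b : Bool) : 0 ≤ btProb r z b := by
  cases b
  · simpa [btProb] using Real.sigmoid_le_one _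
  · simpa [btProb] using Real.sigmoid_nonneg _

theorem btProb_le_one {X : Type u} {Y : Type v} (r : X → Y → ℝ) (z : X × Y × Y) (b : Bool) : btProb r z b ≤ 1 := by
  cases b
  · simpa [btProb] using Real.sigmoid_nonneg _
  · simpa [btProb] using Real.sigmoid_le_one _

/-- The sum over the sample of the deviations of the labels from their conditional means, with
weights `f`. -/
def labelDeviation {X : Type u} {Y : Type v} {M : ℕ} (r : X → Y → ℝ) (f : X × Y × Y → ℝ)
    (x : Fin M → X × Y × Y) (b : Fin M → Bool) : ℝ :=
  ∑ j, ((if b j then 1 else 0) - Real.sigmoid (r (x j).1 (x j).2.1 - r (x j).1 (x j).2.2)) * f (x j)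

theorem abs_labelDeviation_le {X : Type u} {Y : Type v} {M : ℕ} {r : X → Y → ℝ}
    {f : X × Y × Y → ℝ} {c : ℝ} (hc : ∀ z, |f z| ≤ c) (x : Fin M → X × Y × Y)
    (b : Fin M → Bool) : |labelDeviation r f x b| ≤ M * c := by
  calc |labelDeviation r f x b| ≤ ∑ j : Fin M, c := by
        refine (Finset.abs_sum_le_sum_abs _ _).trans (Finset.sum_le_sum fun j _ => ?_)
        rw [abs_mul]
        refine (mul_le_of_le_one_left (abs_nonneg _) ?_).trans (hc _)
        have h0 := Real.sigmoid_nonneg (r (x j).1 (x j).2.1 - r (x j).1 (x j).2.2)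
        have h1 := Real.sigmoid_le_one (r (x j).1 (x j).2.1 - r (x j).1 (x j).2.2)
        refine abs_le.2 ?_
        split_ifs <;> constructor <;> linarith
    _ = M * c := by simp

section Sample

variable {X : Type u} {Y : Type v} [MeasurableSpace X] [MeasurableSpace Y] {M : ℕ}
  {Ω : Type w} [MeasurableSpace Ω] {μ : Measure Ω}
  {r : X → Y → ℝ} {q : Ω → Fin M → X × Y × Y} {lab : Ω → Fin M → Bool}

theorem measurable_rewardDiff (hr : Measurable (Function.uncurry r)) :
    Measurable fun z : X × Y × Y => r z.1 z.2.1 - r z.1 z.2.2 :=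
  (hr.comp (measurable_fst.prodMk (measurable_fst.comp measurable_snd))).sub
    (hr.comp (measurable_fst.prodMk (measurable_snd.comp measurable_snd)))

theorem measurable_btProb (hr : Measurable (Function.uncurry r)) (b : Bool) :
    Measurable fun z => btProb r z b := by
  have h := continuous_sigmoid.measurable.comp (measurable_rewardDiff hr)
  cases b
  · exact measurable_const.sub h
  · exact h

/-- Integration of bounded functions of prompts and labels. -/
theorem IsBTSample.integral_eq [IsProbabilityMeasure μ] (h : IsBTSample μ r q lab) (hr : Measurable (Function.uncurry r))
    {F : (Fin M → X × Y × Y) → (Fin M → Bool) → ℝ} (hF : ∀ b, Measurable fun x => F x b) {c : ℝ}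
    (hc : ∀ x b, |F x b| ≤ c) :
    ∫ ω, F (q ω) (lab ω) ∂μ = ∫ ω, ∑ b, (∏ j, btProb r (q ω j) (b j)) * F (q ω) b ∂μ := by
  have hle : MeasurableSpace.comap q inferInstance ≤ ‹MeasurableSpace Ω› :=
    h.measurable_q.comap_le
  have hset : ∀ b, MeasurableSet {ω | lab ω = b} := fun b =>
    h.measurable_lab (measurableSet_singleton b)
  have hFq : ∀ b, Measurable fun ω => F (q ω) b := fun b => (hF b).comp h.measurable_q
  have hFint : ∀ b, Integrable (fun ω => F (q ω) b) μ := fun b =>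
    Integrable.of_bound (hFq b).aestronglyMeasurable c
      (Filter.Eventually.of_forall fun ω => hc _ _)
  have hind : ∀ b, Integrable ({ω | lab ω = b}.indicator fun _ => (1 : ℝ)) μ := fun b =>
    (integrable_const 1).indicator (hset b)
  have hprod : ∀ b : Fin M → Bool, Measurable fun ω => ∏ j, btProb r (q ω j) (b j) := fun b =>
    Finset.measurable_fun_prod _ fun j _ =>
      (measurable_btProb hr (b j)).comp ((measurable_pi_apply j).comp h.measurable_q)
  have hmulint : ∀ b, Integrable
      ((fun ω => F (q ω) b) * {ω | lab ω = b}.indicator fun _ => (1 : ℝ)) μ := fun b => by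
    refine Integrable.of_bound ((hFq b).mul
      (measurable_const.indicator (hset b))).aestronglyMeasurable c
      (Filter.Eventually.of_forall fun ω => ?_)
    by_cases hω : lab ω = b
    · simpa [hω] using hc (q ω) b
    · simpa [hω] using (abs_nonneg _).trans (hc (q ω) b)
  -- Conditioning on the prompts pulls out `F (q ω) b` and replaces the indicator by the label
  -- probability.
  have hb : ∀ b, ∫ ω, ((fun ω => F (q ω) b) * {ω | lab ω = b}.indicator fun _ => (1 : ℝ)) ω ∂μ
      = ∫ ω, (∏ j, btProb r (q ω j) (b j)) * F (q ω) b ∂μ := fun b => by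
    have hsm : StronglyMeasurable[MeasurableSpace.comap q inferInstance] fun ω => F (q ω) b :=
      ((hF b).comp (comap_measurable q)).stronglyMeasurable
    rw [← integral_condExp hle]
    refine integral_congr_ae ?_
    filter_upwards [condExp_mul_of_stronglyMeasurable_left hsm (hmulint b) (hind b),
      h.label_law b] with ω h1 h2
    rw [h1, Pi.mul_apply, h2, mul_comm]
  have hsplit : ∀ ω, F (q ω) (lab ω)
      = ∑ b, ((fun ω => F (q ω) b) * {ω | lab ω = b}.indicator fun _ => (1 : ℝ)) ω := fun ω => by
    rw [Finset.sum_eq_single (lab ω)]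
    · simp
    · intro b _ hne
      simp [Set.indicator, Ne.symm hne]
    · simp
  simp only [hsplit]
  rw [integral_finsetSum _ fun b _ => hmulint b, integral_finsetSum]
  · exact Finset.sum_congr rfl fun b _ => hb b
  · intro b _
    refine Integrable.of_bound ((hprod b).mul (hFq b)).aestronglyMeasurable c
      (Filter.Eventually.of_forall fun ω => ?_)
    have h0 : 0 ≤ ∏ j, btProb r (q ω j) (b j) :=
      Finset.prod_nonneg fun j _ => btProb_nonneg _ _ _
    rw [Real.norm_eq_abs, abs_mul, abs_of_nonneg h0]
    exact (mul_le_of_le_one_left (abs_nonneg _)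
      (Finset.prod_le_one (fun j _ => btProb_nonneg _ _ _) fun j _ => btProb_le_one _ _ _)).trans
      (hc _ _)

variable {f : X × Y × Y → ℝ}

theorem measurable_labelDeviation (hr : Measurable (Function.uncurry r)) (hf : Measurable f)
    (b : Fin M → Bool) : Measurable fun x : Fin M → X × Y × Y => labelDeviation r f x b :=
  Finset.measurable_fun_sum _ fun j _ => (measurable_const.sub
    ((continuous_sigmoid.measurable.comp (measurable_rewardDiff hr)).comp
      (measurable_pi_apply j))).mul (hf.comp (measurable_pi_apply j))

theorem IsBTSample.measurable_labelDeviation (h : IsBTSample μ r q lab)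
    (hr : Measurable (Function.uncurry r)) (hf : Measurable f) :
    Measurable fun ω => labelDeviation r f (q ω) (lab ω) := by
  have hm : Measurable fun z : (Fin M → X × Y × Y) × (Fin M → Bool) =>
      labelDeviation r f z.1 z.2 :=
    measurable_from_prod_countable_left fun b => MOPO.measurable_labelDeviation hr hf b
  exact hm.comp (h.measurable_q.prodMk h.measurable_lab)

theorem IsBTSample.integrable_exp [IsProbabilityMeasure μ] (h : IsBTSample μ r q lab)
    (hr : Measurable (Function.uncurry r)) (hf : Measurable f) {c : ℝ} (hc : ∀ z, |f z| ≤ c)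
    (t : ℝ) : Integrable (fun ω => Real.exp (t * labelDeviation r f (q ω) (lab ω))) μ := by
  refine Integrable.of_bound (Real.measurable_exp.comp
    ((h.measurable_labelDeviation hr hf).const_mul t)).aestronglyMeasurable
    (Real.exp (|t| * (M * c))) (Filter.Eventually.of_forall fun ω => ?_)
  rw [Real.norm_eq_abs, Real.abs_exp]
  refine Real.exp_le_exp.2 ((le_abs_self _).trans ?_)
  rw [abs_mul]
  exact mul_le_mul_of_nonneg_left (abs_labelDeviation_le hc _ _) (abs_nonneg t)

/-- For fixed prompts the sum over label vectors factorizes into Bernoulli moment generating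
functions, with a bound uniform in the prompts; hence their joint law is irrelevant. -/
theorem IsBTSample.mgf_le [IsProbabilityMeasure μ] (h : IsBTSample μ r q lab) (hr : Measurable (Function.uncurry r))
    (hf : Measurable f) {c : ℝ} (hc : ∀ z, |f z| ≤ c) (t : ℝ) :
    mgf (fun ω => labelDeviation r f (q ω) (lab ω)) μ t ≤ Real.exp (M * (t ^ 2 * c ^ 2 / 2)) := by
  unfold mgf
  rw [h.integral_eq hr (F := fun x b => Real.exp (t * labelDeviation r f x b))
    (fun b => Real.measurable_exp.comp ((MOPO.measurable_labelDeviation hr hf b).const_mul t))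
    (c := Real.exp (|t| * (M * c))) fun x b => ?_]
  swap
  · rw [Real.abs_exp]
    refine Real.exp_le_exp.2 ((le_abs_self _).trans ?_)
    rw [abs_mul]
    exact mul_le_mul_of_nonneg_left (abs_labelDeviation_le hc _ _) (abs_nonneg t)
  have hpt : ∀ x : Fin M → X × Y × Y, ∑ b : Fin M → Bool, (∏ j, btProb r (x j) (b j))
      * Real.exp (t * labelDeviation r f x b) ≤ Real.exp (M * (t ^ 2 * c ^ 2 / 2)) := fun x => by
    have h1 : ∀ b : Fin M → Bool, (∏ j, btProb r (x j) (b j))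
        * Real.exp (t * labelDeviation r f x b)
        = ∏ j, btProb r (x j) (b j) * Real.exp (t * (((if b j then 1 else 0)
          - Real.sigmoid (r (x j).1 (x j).2.1 - r (x j).1 (x j).2.2)) * f (x j))) := fun b => by
      rw [labelDeviation, Finset.mul_sum, Real.exp_sum, Finset.prod_mul_distrib]
    simp only [h1]
    rw [← Fintype.piFinset_univ, ← Finset.prod_univ_sum (fun _ => Finset.univ)
      (fun j b => btProb r (x j) b * Real.exp (t * (((if b then 1 else 0)
          - Real.sigmoid (r (x j).1 (x j).2.1 - r (x j).1 (x j).2.2)) * f (x j))))]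
    have h2 : Real.exp (M * (t ^ 2 * c ^ 2 / 2)) = ∏ _j : Fin M, Real.exp (t ^ 2 * c ^ 2 / 2) := by
      rw [Finset.prod_const, Finset.card_univ, Fintype.card_fin, ← Real.exp_nat_mul]
    rw [h2]
    refine Finset.prod_le_prod (fun j _ => Finset.sum_nonneg fun b _ =>
      mul_nonneg (btProb_nonneg _ _ _) (Real.exp_pos _).le) fun j _ => ?_
    set p := Real.sigmoid (r (x j).1 (x j).2.1 - r (x j).1 (x j).2.2) with hp
    have h3 := bernoulli_mgf_le (Real.sigmoid_nonneg _) (Real.sigmoid_le_one _) (t * f (x j))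
      (p := p)
    rw [Fintype.sum_bool]
    simp only [btProb, if_true, Bool.false_eq_true, if_false, ← hp]
    have h4 : t * ((1 - p) * f (x j)) = (1 - p) * (t * f (x j)) := by ring
    have h5 : t * ((0 - p) * f (x j)) = -p * (t * f (x j)) := by ring
    rw [h4, h5]
    refine h3.trans (Real.exp_le_exp.2 ?_)
    have h6 : f (x j) ^ 2 ≤ c ^ 2 := by
      rw [← sq_abs]; exact pow_le_pow_left₀ (abs_nonneg _) (hc _) 2
    have h7 := mul_le_mul_of_nonneg_left h6 (sq_nonneg t)
    rw [mul_pow]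
    linarith
  calc _ ≤ ∫ _ω, Real.exp (M * (t ^ 2 * c ^ 2 / 2)) ∂μ := by
        refine integral_mono_of_nonneg (Filter.Eventually.of_forall fun ω =>
          Finset.sum_nonneg fun b _ => mul_nonneg
            (Finset.prod_nonneg fun j _ => btProb_nonneg _ _ _) (Real.exp_pos _).le)
          (integrable_const _) (Filter.Eventually.of_forall fun ω => hpt (q ω))
    _ = _ := by simp

/-- Hoeffding's inequality for the labels. -/
theorem IsBTSample.measure_abs_labelDeviation_ge_le [IsProbabilityMeasure μ] (h : IsBTSample μ r q lab) (hM : 1 ≤ M)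
    (hr : Measurable (Function.uncurry r)) (hf : Measurable f) (hc : ∀ z, |f z| ≤ 2) {s : ℝ}
    (hs : 0 ≤ s) :
    μ {ω | s ≤ |labelDeviation r f (q ω) (lab ω)|}
      ≤ ENNReal.ofReal (2 * Real.exp (-s ^ 2 / (8 * M))) := by
  have hMr : (0 : ℝ) < M := by positivity
  set Z := fun ω => labelDeviation r f (q ω) (lab ω) with hZ
  have hmgf : ∀ t, mgf Z μ t ≤ Real.exp (M * (t ^ 2 * 2 ^ 2 / 2)) := h.mgf_le hr hf hc
  -- The minimizer of the Chernoff exponent `-t * s + 2 * M * t ^ 2`.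
  set t := s / (4 * M) with ht
  have ht0 : 0 ≤ t := by positivity
  have hexp : Real.exp (-t * s) * Real.exp (M * (t ^ 2 * 2 ^ 2 / 2))
      = Real.exp (-s ^ 2 / (8 * M)) := by
    rw [← Real.exp_add, ht]
    congr 1
    field_simp
    ring
  have h1 : μ.real {ω | s ≤ Z ω} ≤ Real.exp (-s ^ 2 / (8 * M)) := by
    refine (measure_ge_le_exp_mul_mgf s ht0 (h.integrable_exp hr hf hc t)).trans ?_
    rw [← hexp]
    exact mul_le_mul_of_nonneg_left (hmgf t) (Real.exp_pos _).le
  have h2 : μ.real {ω | Z ω ≤ -s} ≤ Real.exp (-s ^ 2 / (8 * M)) := by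
    refine (measure_le_le_exp_mul_mgf (-s) (neg_nonpos.2 ht0)
      (h.integrable_exp hr hf hc (-t))).trans ?_
    rw [← hexp]
    have h3 := mul_le_mul_of_nonneg_left (hmgf (-t)) (Real.exp_pos (-t * s)).le
    rw [neg_sq] at h3
    simpa using h3
  have hsub : {ω | s ≤ |Z ω|} ⊆ {ω | s ≤ Z ω} ∪ {ω | Z ω ≤ -s} := fun ω hω => by
    rcases le_abs.1 (show s ≤ |Z ω| from hω) with h | h
    · exact Or.inl h
    · exact Or.inr (show Z ω ≤ -s by linarith)
  calc μ {ω | s ≤ |Z ω|} ≤ μ {ω | s ≤ Z ω} + μ {ω | Z ω ≤ -s} :=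
        (measure_mono hsub).trans (measure_union_le _ _)
    _ = ENNReal.ofReal (μ.real {ω | s ≤ Z ω}) + ENNReal.ofReal (μ.real {ω | Z ω ≤ -s}) := by
        rw [ofReal_measureReal, ofReal_measureReal]
    _ ≤ _ := by
        rw [two_mul, ENNReal.ofReal_add (Real.exp_pos _).le (Real.exp_pos _).le]
        exact add_le_add (ENNReal.ofReal_le_ofReal h1) (ENNReal.ofReal_le_ofReal h2)

end Sample

namespace Model

variable {X : Type u} {Y : Type v} [MeasurableSpace X] [MeasurableSpace Y] {m d M : ℕ}

theorem measurable_featureDiff (Q : Model X Y m d) (i : Fin m) : Measurable (Q.featureDiff i) :=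
  ((Q.φ_measurable i).comp (measurable_fst.prodMk (measurable_fst.comp measurable_snd))).sub
    ((Q.φ_measurable i).comp (measurable_fst.prodMk (measurable_snd.comp measurable_snd)))

theorem abs_featureDiff_apply_le (Q : Model X Y m d) (i : Fin m) (z : X × Y × Y) (a : Fin d) :
    |Q.featureDiff i z a| ≤ 2 := by
  have h1 := PiLp.norm_apply_le (Q.featureDiff i z) a
  have h2 := norm_sub_le (Q.φ i z.1 z.2.1) (Q.φ i z.1 z.2.2)
  have h3 := Q.φ_norm i z.1 z.2.1
  have h4 := Q.φ_norm i z.1 z.2.2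
  rw [Real.norm_eq_abs] at h1
  exact h1.trans (h2.trans (by linarith))

/-- Exchanging winner and loser flips the feature difference, and `1 - σ(-z) = σ(z)`. So the score
is a sum of centered labels with weights that depend on the prompts alone. -/
theorem score_comparisons_apply (Q : Model X Y m d) (i : Fin m) (q : Fin M → X × Y × Y)
    (lab : Fin M → Bool) (θ : Vec d) (a : Fin d) :
    Q.score i (comparisons q lab) θ a
      = labelDeviation (Q.reward i θ) (fun z => Q.featureDiff i z a) q lab := by
  simp only [score, labelDeviation, WithLp.ofLp_sum, Finset.sum_apply, PiLp.smul_apply,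
    smul_eq_mul, reward_sub_reward]
  refine Finset.sum_congr rfl fun j _ => ?_
  cases hj : lab j
  · have h1 : Q.featureDiff i (comparisons q lab j) = -Q.featureDiff i (q j) := by
      simp [comparisons, hj, featureDiff]
    rw [h1, inner_neg_right, Real.sigmoid_neg]
    simp
  · have h1 : Q.featureDiff i (comparisons q lab j) = Q.featureDiff i (q j) := by
      simp [comparisons, hj]
    rw [h1]
    simp

/-- With high probability, all scores at the true parameters are of order `√(d M)`. -/
theorem measure_score_gt_le (Q : Model X Y m d) (hm : 1 ≤ m) (hd : 1 ≤ d) (hM : 1 ≤ M)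
    {Ω : Type w} [MeasurableSpace Ω] {μ : Measure Ω} [IsProbabilityMeasure μ]
    {q : Fin m → Ω → Fin M → X × Y × Y} {lab : Fin m → Ω → Fin M → Bool}
    (h : ∀ i, IsBTSample μ (Q.reward i (Q.θstar i)) (q i) (lab i)) {δ : ℝ} (hδ : 0 < δ)
    (hδ1 : δ < 1) :
    μ {ω | ¬ ∀ i, ‖Q.score i (comparisons (q i ω) (lab i ω)) (Q.θstar i)‖
      ≤ √(8 * M * Real.log (2 * m * d / δ)) * √(d : ℝ)} ≤ ENNReal.ofReal δ := by
  have hmr : (1 : ℝ) ≤ m := by exact_mod_cast hm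
  have hdr : (1 : ℝ) ≤ d := by exact_mod_cast hd
  have hMr : (0 : ℝ) < M := by positivity
  set L := Real.log (2 * m * d / δ) with hL
  have hmd : (1 : ℝ) ≤ m * d := one_le_mul_of_one_le_of_one_le hmr hdr
  have hL0 : 0 ≤ L := Real.log_nonneg (by rw [le_div_iff₀ hδ]; linarith)
  -- Chosen so that each of the `m * d` coordinates exceeds `s` with probability at most `δ / (m *
  -- d)`.
  set s := √(8 * M * L) with hs
  have hs2 : s ^ 2 = 8 * M * L := Real.sq_sqrt (by positivity)
  have hsub : {ω | ¬ ∀ i, ‖Q.score i (comparisons (q i ω) (lab i ω)) (Q.θstar i)‖ ≤ s * √(d : ℝ)}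
      ⊆ ⋃ ia : Fin m × Fin d, {ω | s ≤ |labelDeviation (Q.reward ia.1 (Q.θstar ia.1))
        (fun z => Q.featureDiff ia.1 z ia.2) (q ia.1 ω) (lab ia.1 ω)|} := fun ω hω => by
    by_contra hcon
    simp only [Set.mem_iUnion, Set.mem_ofPred_eq, not_exists, not_le] at hcon
    refine hω fun i => norm_le_sqrt_mul (Real.sqrt_nonneg _) fun a => ?_
    rw [score_comparisons_apply]
    exact (hcon (i, a)).le
  refine (measure_mono hsub).trans ((measure_iUnion_fintype_le _ _).trans ?_)
  have hexp : Real.exp (-s ^ 2 / (8 * M)) = δ / (2 * m * d) := by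
    have : -s ^ 2 / (8 * M) = -L := by rw [hs2]; field_simp
    rw [this, hL, Real.exp_neg, Real.exp_log (by positivity), inv_div]
  calc _ ≤ ∑ _ia : Fin m × Fin d, ENNReal.ofReal (2 * (δ / (2 * m * d))) :=
        Finset.sum_le_sum fun ia _ => by
          rw [← hexp]
          exact (h ia.1).measure_abs_labelDeviation_ge_le hM (Q.measurable_reward _ _)
            (measurable_pi_apply ia.2 |>.comp
              ((WithLp.measurable_ofLp 2 _).comp (Q.measurable_featureDiff ia.1)))
            (fun z => Q.abs_featureDiff_apply_le ia.1 z ia.2) (Real.sqrt_nonneg _)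
    _ = ENNReal.ofReal δ := by
        rw [Finset.sum_const, Finset.card_univ, Fintype.card_prod, Fintype.card_fin,
          Fintype.card_fin, nsmul_eq_mul, ← ENNReal.ofReal_natCast,
          ← ENNReal.ofReal_mul (by positivity)]
        congr 1
        push_cast
        field_simp

end Model

/-! ### Suboptimality of the averaged policy and collection of constants. -/

theorem norm_runningAverage_sub_le {m : ℕ} {V V' : ℕ → Vec m} {ε : ℝ} {t : ℕ} (ht : 1 ≤ t)
    (h : ∀ j ∈ Finset.Icc 1 t, ‖V j - V' j‖ ≤ ε) :
    ‖runningAverage V t - runningAverage V' t‖ ≤ ε := by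
  have ht0 : (0 : ℝ) < t := by positivity
  rw [runningAverage, runningAverage, ← smul_sub, ← Finset.sum_sub_distrib, norm_smul,
    Real.norm_of_nonneg (by positivity), inv_mul_le_iff₀ ht0]
  calc _ ≤ ∑ j ∈ Finset.Icc 1 t, ‖V j - V' j‖ := norm_sum_le _ _
    _ ≤ ∑ j ∈ Finset.Icc 1 t, ε := Finset.sum_le_sum h
    _ = t * ε := by simp

namespace Model

variable {X : Type u} {Y : Type v} [MeasurableSpace X] [MeasurableSpace Y] {m d M : ℕ}

theorem norm_S_sub_valueVec_le (Q : Model X Y m d) {π : Kernel X Y} [IsMarkovKernel π]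
    (θ : Fin m → Vec d) :
    ‖Q.S π - Q.valueVec θ π‖ ≤ √(∑ i, ‖θ i - Q.θstar i‖ ^ 2) := by
  rw [EuclideanSpace.norm_eq]
  refine Real.sqrt_le_sqrt (Finset.sum_le_sum fun i _ => ?_)
  refine pow_le_pow_left₀ (norm_nonneg _) ?_ 2
  have h1 := Q.valueVec_le (π := π) θ Q.θstar i
  have h2 := Q.valueVec_le (π := π) Q.θstar θ i
  rw [norm_sub_rev] at h2
  simp only [S, PiLp.sub_apply, Real.norm_eq_abs]
  exact abs_le.2 ⟨by linarith, by linarith⟩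

theorem IsRun.mem_simplex {Q : Model X Y m d} {N : ℕ} {g : Fin N → Group m} {η : ℝ}
    {data : Fin m → Fin M → X × Y × Y} {T : ℕ} {e : ℕ → Vec m} {θ : ℕ → Fin m → Vec d}
    {π : ℕ → Kernel X Y} (h : Q.IsRun (consensusTarget g) η data T e θ π) :
    ∀ t ∈ Finset.Icc 1 T, e t ∈ simplex m := by
  intro t ht
  obtain ⟨h1, h2⟩ := Finset.mem_Icc.1 ht
  obtain ⟨t, rfl⟩ : ∃ k, t = k + 1 := ⟨t - 1, by omega⟩
  rcases Nat.eq_zero_or_pos t with rfl | ht0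
  · exact h.init
  · exact (h.direction t (Finset.mem_Icc.2 ⟨ht0, by omega⟩) (by omega)).mem_simplex
      (convex_consensusTarget g) fun _ hz _ h => consensusTarget_upward g hz h

/-- The suboptimality of the averaged policy, given the accuracy of the estimates. -/
theorem IsRun.D_avgPolicy_le [MeasurableSpace.CountablyGenerated Y] {Q : Model X Y m d} {N : ℕ}
    {g : Fin N → Group m} {η : ℝ} {data : Fin m → Fin M → X × Y × Y} {T : ℕ} {e : ℕ → Vec m}
    {θ : ℕ → Fin m → Vec d} {π : ℕ → Kernel X Y}
    (h : Q.IsRun (consensusTarget g) η data T e θ π) (hT : 1 ≤ T)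
    (hstar : ∀ i, Q.θstar i ∈ Q.paramSet i) {π₀ : Kernel X Y} (hπ₀ : Q.IsPolicy π₀) {ε : ℝ}
    (hε : ∀ t ∈ Finset.Icc 1 T, √(∑ i, ‖θ t i - Q.θstar i‖ ^ 2) ≤ ε) :
    Q.D (consensusTarget g) (avgPolicy T π) - Q.D (consensusTarget g) π₀
      ≤ 2 * ε + 2 * (Q.B * √(m : ℝ) / √(T : ℝ)) := by
  have hW := convex_consensusTarget g
  have hW' : ∀ z ∈ consensusTarget g, ∀ z' : Vec m, (∀ i, z i ≤ z' i) →
      z' ∈ consensusTarget g := fun _ hz _ h => consensusTarget_upward g hz h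
  have he := h.mem_simplex
  have hm0 := hπ₀.1
  have hε0 : 0 ≤ ε := (Real.sqrt_nonneg _).trans (hε 1 (Finset.mem_Icc.2 ⟨le_rfl, hT⟩))
  -- The first `ε` pays for judging `π₀` by the estimates; the second, in `h4`, for returning from
  -- estimated to true values of the `π t`.
  have h1 : Metric.infDist (runningAverage (fun t => Q.valueVec (θ t) (π t)) T)
      (consensusTarget g)
      ≤ Metric.infDist (Q.S π₀) (consensusTarget g) + ε + 2 * (Q.B * √(m : ℝ) / √(T : ℝ)) := by
    refine infDist_runningAverage_le hW hW' (e := e)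
      (Δ := fun t i => ‖θ t i - Q.θstar i‖) hT (zero_le_one.trans Q.one_le_B) hε0
      h.direction hε (fun t ht => ?_) (fun t ht i => ?_) fun i => Q.valueVec_le_bound hstar i
    · have h2 := Q.J_le (π := π₀) (he t ht) Q.θstar (θ t)
      have h3 := (h.greedy t ht).2 _ hπ₀
      simp only [J_eq_sum_valueVec, norm_sub_rev (Q.θstar _)] at h2 h3
      simp only [S]
      linarith
    · exact (h.greedy t ht).abs_valueVec_le (he t ht) (h.estimate t ht).1 i
  have h2 : Metric.infDist (Q.S (avgPolicy T π)) (consensusTarget g)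
      ≤ Metric.infDist (runningAverage (fun t => Q.S (π t)) T) (consensusTarget g) :=
    infDist_le_of_le hW' fun i => Q.runningAverage_S_le hT (fun t ht => (h.greedy t ht).1) i
  have h3 := Metric.infDist_le_infDist_add_dist (s := consensusTarget g)
    (x := runningAverage (fun t => Q.S (π t)) T)
    (y := runningAverage (fun t => Q.valueVec (θ t) (π t)) T)
  have h4 : dist (runningAverage (fun t => Q.S (π t)) T)
      (runningAverage (fun t => Q.valueVec (θ t) (π t)) T) ≤ ε := by
    rw [dist_eq_norm]
    refine norm_runningAverage_sub_le hT fun t ht => ?_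
    have := (h.greedy t ht).1.1
    exact (Q.norm_S_sub_valueVec_le (θ t)).trans (hε t ht)
  simp only [D]
  linarith

end Model

/-- Collecting the constants of the statistical error. -/
theorem statistical_error_le {m d M : ℕ} (hm : 1 ≤ m) (hd : 1 ≤ d) (hM : 1 ≤ M) {δ : ℝ}
    (hδ : 0 < δ) (hδ1 : δ < 1) {x y : ℝ} (hx : 0 ≤ x) (hy : 0 ≤ y) :
    2 * (√(m : ℝ) * (8 * (√(8 * Real.log (2 * m * d / δ)) * √(d : ℝ) + 1) * x * y
        + 2 * x * (1 + y)) / √(M : ℝ))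
      ≤ (m : ℝ) ^ (3 / 2 : ℝ) * √(d : ℝ) / √(M : ℝ)
        * ((68 * x * y + 4 * x) * (1 + Real.log (m * d * M / δ))) := by
  have hmr : (1 : ℝ) ≤ m := by exact_mod_cast hm
  have hdr : (1 : ℝ) ≤ d := by exact_mod_cast hd
  have hMr : (1 : ℝ) ≤ M := by exact_mod_cast hM
  have hmd : (1 : ℝ) ≤ m * d := one_le_mul_of_one_le_of_one_le hmr hdr
  have hmdM : (1 : ℝ) ≤ m * d * M := one_le_mul_of_one_le_of_one_le hmd hMr
  set A := 1 + Real.log (m * d * M / δ) with hA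
  have hA1 : 1 ≤ A := by
    have : 0 ≤ Real.log (m * d * M / δ) :=
      Real.log_nonneg (by rw [le_div_iff₀ hδ]; linarith)
    linarith
  have hL : Real.log (2 * m * d / δ) ≤ A := by
    have h1 : 2 * (m : ℝ) * d / δ = 2 * (m * d / δ) := by ring
    have h2 : Real.log (m * d / δ) ≤ Real.log (m * d * M / δ) := by
      refine Real.log_le_log (by positivity) (div_le_div_of_nonneg_right ?_ hδ.le)
      exact le_mul_of_one_le_right (by positivity) hMr
    rw [h1, Real.log_mul (by norm_num) (by positivity)]
    have h3 := Real.log_two_lt_d9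
    linarith
  have hsd : 1 ≤ √(d : ℝ) := Real.one_le_sqrt.2 hdr
  -- The argument yields the power `1 / 2` of `m`; it is relaxed here to the stated one.
  have hsm : √(m : ℝ) ≤ (m : ℝ) ^ (3 / 2 : ℝ) := by
    rw [Real.sqrt_eq_rpow]
    exact Real.rpow_le_rpow_of_exponent_le hmr (by norm_num)
  have hsL : √(8 * Real.log (2 * m * d / δ)) ≤ 3 * A := by
    refine Real.sqrt_le_iff.2 ⟨by positivity, ?_⟩
    nlinarith
  set H := √(d : ℝ) * A with hH
  have hH1 : 1 ≤ H := one_le_mul_of_one_le_of_one_le hsd hA1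
  have hG : √(8 * Real.log (2 * m * d / δ)) * √(d : ℝ) + 1 ≤ 4 * H := by
    have := mul_le_mul_of_nonneg_right hsL (Real.sqrt_nonneg (d : ℝ))
    have h2 : 3 * A * √(d : ℝ) = 3 * H := by rw [hH]; ring
    linarith
  have hxy : 0 ≤ x * y := mul_nonneg hx hy
  -- The coefficient `68` is `2 * 8 * 4`, from `hG`, plus `4` from the term `2 * x * (1 + y)`.
  have hin : 2 * (8 * (√(8 * Real.log (2 * m * d / δ)) * √(d : ℝ) + 1) * x * y
      + 2 * x * (1 + y)) ≤ H * (68 * x * y + 4 * x) := by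
    have h1 := mul_le_mul_of_nonneg_right hG hxy
    have h2 := mul_le_mul_of_nonneg_right hH1 (show 0 ≤ 4 * x + 4 * (x * y) by positivity)
    linarith
  have hsM : 0 ≤ (√(M : ℝ))⁻¹ := by positivity
  calc _ = √(m : ℝ) * (2 * (8 * (√(8 * Real.log (2 * m * d / δ)) * √(d : ℝ) + 1) * x * y
      + 2 * x * (1 + y))) * (√(M : ℝ))⁻¹ := by ring
    _ ≤ (m : ℝ) ^ (3 / 2 : ℝ) * (H * (68 * x * y + 4 * x)) * (√(M : ℝ))⁻¹ := by
      refine mul_le_mul_of_nonneg_right (mul_le_mul hsm hin ?_ (by positivity)) hsM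
      positivity
    _ = _ := by rw [hH]; ring

end MOPO

end

open MOPO in
/-- The constants `P`, `c`, `k` (a bivariate polynomial, a factor and a power of logarithms) are
universal: they are chosen before the spaces, the dimensions and all other parameters. -/
theorem theorem2 :
    ∃ (P : MvPolynomial (Fin 2) ℝ) (c : ℝ) (k : ℕ),
      ∀ (X : Type u) (Y : Type v) (Ω : Type w) [MeasurableSpace X] [MeasurableSpace Y]
        [MeasurableSpace Ω] [MeasurableSpace.CountablyGenerated Y]
        (m d M T N : ℕ) (_ : 1 ≤ m) (_ : 1 ≤ d) (_ : 1 ≤ M) (_ : 1 ≤ T)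
        (Q : Model X Y m d) (_ : ∀ i, Q.θstar i ∈ Q.paramSet i)
        (B' : ℝ) (_ : ∀ i, ∀ θ ∈ Q.paramSet i, ‖θ‖ ≤ B')
        (g : Fin N → Group m) (piStar : Kernel X Y)
        (_ : Q.IsOptimal (consensusTarget g) piStar)
        (μ : Measure Ω) [IsProbabilityMeasure μ]
        (q : Fin m → Ω → Fin M → X × Y × Y) (lab : Fin m → Ω → Fin M → Bool)
        (_ : ∀ i, IsBTSample μ (Q.reward i (Q.θstar i)) (q i) (lab i))
        (δ : ℝ) (_ : 0 < δ) (_ : δ < 1),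
        let data : Ω → Fin m → Fin M → X × Y × Y := fun ω i => comparisons (q i ω) (lab i ω)
        let W : Set (Vec m) := consensusTarget g
        let η : ℝ := 1 / √(M : ℝ)
        let coverage : Ω → ℝ := fun ω =>
          ((⨅ i, lambdaMin (Q.empCov i (data ω i))) + 1 / (M : ℝ))⁻¹
        μ {ω | ¬ ∀ (e : ℕ → Vec m) (θ : ℕ → Fin m → Vec d) (π : ℕ → Kernel X Y),
          Q.IsRun W η (data ω) T e θ π →
            Q.IsPolicy (avgPolicy T π) ∧
            Q.D W (avgPolicy T π) - Q.D W piStar ≤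
              (m : ℝ) ^ (3 / 2 : ℝ) * √(d : ℝ) / √(M : ℝ) *
                  (MvPolynomial.eval ![Real.exp B', coverage ω] P *
                    (1 + Real.log (m * d * M / δ)) ^ k)
                + c * (Q.B * √(m : ℝ) / √(T : ℝ)) * (1 + Real.log T) ^ k}
          ≤ ENNReal.ofReal δ := by
  refine ⟨MvPolynomial.C 68 * MvPolynomial.X 0 * MvPolynomial.X 1
    + MvPolynomial.C 4 * MvPolynomial.X 0, 2, 1, ?_⟩
  intro X Y Ω _ _ _ _ m d M T N hm hd hM hT Q hstar B' hB' g piStar hpi μ _ q lab hsample δ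
    hδ hδ1 data W η coverage
  -- Every failing outcome has a large score. Runs are quantified inside the event, so no measurable
  -- selection of a run is needed.
  refine le_trans (measure_mono fun ω hω => ?_)
    (Q.measure_score_gt_le hm hd hM hsample hδ hδ1)
  refine fun hscore => hω fun e θ π hrun => ?_
  refine ⟨Q.isPolicy_avgPolicy hT fun t ht => (hrun.greedy t ht).1, ?_⟩
  have hMr : (0 : ℝ) < M := by positivity
  have hsM : 0 < √(M : ℝ) := Real.sqrt_pos.2 hMr
  have hl0 : ∀ i, 0 ≤ lambdaMin (Q.empCov i (data ω i)) := fun i =>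
    lambdaMin_nonneg (Q.posSemidef_empCov i (data ω i))
  have hl : 0 ≤ ⨅ i, lambdaMin (Q.empCov i (data ω i)) := Real.iInf_nonneg hl0
  have hcov : 0 ≤ coverage ω := inv_nonneg.2 (by positivity)
  have hest : ∀ t ∈ Finset.Icc 1 T, √(∑ i, ‖θ t i - Q.θstar i‖ ^ 2)
      ≤ √(m : ℝ) * (8 * (√(8 * Real.log (2 * m * d / δ)) * √(d : ℝ) + 1) * Real.exp B'
        * coverage ω + 2 * Real.exp B' * (1 + coverage ω)) / √(M : ℝ) := fun t ht => by
    rw [le_div_iff₀' hsM]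
    refine (hrun.estimate t ht).sqrt_sum_le hM hstar hB' (hrun.mem_simplex t ht)
      (by positivity) (fun i => ?_) hl fun i => ciInf_le (Set.finite_range _).bddBelow i
    refine (hscore i).trans_eq ?_
    have : 8 * (M : ℝ) * Real.log (2 * m * d / δ) = (8 * Real.log (2 * m * d / δ)) * M := by ring
    rw [this, Real.sqrt_mul' _ hMr.le]
    ring
  have h1 := hrun.D_avgPolicy_le hT hstar hpi.1 hest
  have h2 := statistical_error_le hm hd hM hδ hδ1 (Real.exp_pos B').le hcov
  have h3 : 2 * (Q.B * √(m : ℝ) / √(T : ℝ))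
      ≤ 2 * (Q.B * √(m : ℝ) / √(T : ℝ)) * (1 + Real.log T) := by
    have hB := zero_le_one.trans Q.one_le_B
    refine le_mul_of_one_le_right (by positivity) ?_
    have := Real.log_nonneg (show (1 : ℝ) ≤ T by exact_mod_cast hT)
    linarith
  have h4 : MvPolynomial.eval ![Real.exp B', coverage ω]
      (MvPolynomial.C 68 * MvPolynomial.X 0 * MvPolynomial.X 1
        + MvPolynomial.C 4 * MvPolynomial.X 0)
      = 68 * Real.exp B' * coverage ω + 4 * Real.exp B' := by
    simp
  rw [h4, pow_one, pow_one]
  linarith
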